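/- Let $p$ be a prime and let $\mathbb F$ be a perfect field of characteristic $p$. For a restricted Lie algebra $L$ over $\mathbb F$ with $p$-map $x\mapsto x^{[p]}$, let $u(L)$ denote its restricted enveloping algebra (the quotient of the universal enveloping algebra of $L$ by the ideal generated by all $x^p-x^{[p]}$, $x\in L$), let $L'=[L,L]$ and $\gamma_3(L)=[L,[L,L]]$, and let $L'^p$ denote the restricted Lie subalgebra of $L$ generated by all $x^{[p]}$ with $x\in L'$. Then $L'^p+\gamma_3(L)$ is an ideal of $L$ closed under the $p$-map, so that $L/(L'^p+\gamma_3(L))$ is again a restricted Lie algebra. Let $L$ be a finite-dimensional restricted Lie algebra over $\mathbb F$ that is $p$-nilpotent, i.e. there is an $n$ such that $x^{[p]^n}=0$ for all $x\in L$. Let $H$ be any restricted Lie algebra over $\mathbb F$ such that $u(L)\cong u(H)$ as associative $\mathbb F$-algebras. Then $$L/(L'^p+\gamma_3(L))\;\cong\; H/(H'^p+\gamma_3(H))$$ as restricted Lie algebras over $\mathbb F$. -/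

import Mathlib

section

open Polynomial

/-- The Jacobson term `s_i(x, y)`: `i • s_i(x, y)` is the coefficient of `t ^ (i - 1)` in
`(ad (t x + y)) ^ (p - 1) (x)`, where `t` is a commuting indeterminate. -/
noncomputable def jacobsonTerm (p : ℕ) (F : Type*) {L : Type*} [Field F] [LieRing L]
    [LieAlgebra F L] (x y : L) (i : ℕ) : L :=
  ((i : F)⁻¹) •
    (((C (LieAlgebra.ad F L x) * X + C (LieAlgebra.ad F L y) : (Module.End F L)[X]) ^
      (p - 1)).coeff (i - 1)) x

/-- A restricted Lie algebra over a field `F` (to be used when `F` has prime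
characteristic `p`): a Lie algebra with a `p`-map in the sense of Jacobson. -/
class RestrictedLieAlgebra (p : ℕ) (F : Type*) (L : Type*) [Field F] [LieRing L]
    [LieAlgebra F L] where
  /-- The `p`-map `x ↦ x^[p]`. -/
  pMap : L → L
  pMap_smul : ∀ (a : F) (x : L), pMap (a • x) = a ^ p • pMap x
  ad_pMap : ∀ x : L, LieAlgebra.ad F L (pMap x) = LieAlgebra.ad F L x ^ p
  pMap_add : ∀ x y : L,
    pMap (x + y) = pMap x + pMap y + ∑ i ∈ Finset.Ico 1 p, jacobsonTerm p F x y i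

namespace RestrictedLieAlgebra

section Basic

variable (p : ℕ) (F : Type*) (L : Type*) [Field F] [LieRing L] [LieAlgebra F L]
  [RestrictedLieAlgebra p F L]

/-- `L` is `p`-nilpotent if some iterate of the `p`-map kills `L`. -/
def IsPNilpotent : Prop :=
  ∃ n : ℕ, ∀ x : L, (pMap p F : L → L)^[n] x = 0

/-- The defining relations of the restricted enveloping algebra: `x ^ p = x^[p]`. -/
inductive EnvelopingRel :
    UniversalEnvelopingAlgebra F L → UniversalEnvelopingAlgebra F L → Prop
  | pow_eq (x : L) : EnvelopingRel (UniversalEnvelopingAlgebra.ι F x ^ p)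
      (UniversalEnvelopingAlgebra.ι F (pMap p F x))

/-- The restricted enveloping algebra `u(L)`. -/
abbrev RestrictedEnvelopingAlgebra : Type _ := RingQuot (EnvelopingRel p F L)

variable {L} in
/-- The restricted Lie subalgebra generated by a set: the smallest Lie subalgebra containing
the set and closed under the `p`-map. -/
def restrictedClosure (S : Set L) : LieSubalgebra F L :=
  sInf {K : LieSubalgebra F L | S ⊆ K ∧ ∀ x ∈ K, pMap p F x ∈ K}

variable {L F} in
/-- For a Lie subalgebra `I`, the restricted Lie subalgebra `I^p` generated by all `x^[p]`,
`x ∈ I`. -/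
def pPower (I : LieSubalgebra F L) : LieSubalgebra F L :=
  restrictedClosure p F (pMap p F '' (I : Set L))

end Basic

/-- The derived subalgebra `L' = [L, L]`. -/
abbrev derivedIdeal (F L : Type*) [Field F] [LieRing L] [LieAlgebra F L] : LieIdeal F L :=
  ⁅(⊤ : LieIdeal F L), (⊤ : LieIdeal F L)⁆

/-- The third term `γ₃(L) = [L, [L, L]]` of the lower central series (Mathlib numbers the
series from `0`, so that `γ₁(L) = L` has index `0`). -/
abbrev gammaThree (F L : Type*) [Field F] [LieRing L] [LieAlgebra F L] : LieIdeal F L :=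
  LieModule.lowerCentralSeries F L L 2

section Jacobson

variable {F L M : Type*} [Field F] [LieRing L] [LieAlgebra F L] [LieRing M] [LieAlgebra F M]

theorem map_coeff_pow (f : L →ₗ⁅F⁆ M) (x y : L) (n : ℕ) : ∀ (k : ℕ) (z : L),
    f ((((C (LieAlgebra.ad F L x) * X + C (LieAlgebra.ad F L y) : (Module.End F L)[X]) ^
      n).coeff k) z) =
    (((C (LieAlgebra.ad F M (f x)) * X + C (LieAlgebra.ad F M (f y)) :
      (Module.End F M)[X]) ^ n).coeff k) (f z) := by
  induction n with
  | zero =>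
    intro k z
    rcases k with _ | k <;> simp [coeff_one]
  | succ n ih =>
    intro k z
    rw [pow_succ', pow_succ', add_mul, add_mul, mul_assoc, mul_assoc]
    rcases k with _ | k <;> simp [ih, LieHom.map_lie]

theorem map_jacobsonTerm (p : ℕ) (f : L →ₗ⁅F⁆ M) (x y : L) (i : ℕ) :
    f (jacobsonTerm p F x y i) = jacobsonTerm p F (f x) (f y) i := by
  rw [jacobsonTerm, jacobsonTerm, map_smul, map_coeff_pow]

theorem jacobsonTerm_zero_right {p : ℕ} (hp : p.Prime) (x : L) (i : ℕ) :
    jacobsonTerm p F x 0 i = 0 := by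
  obtain ⟨n, hn⟩ : ∃ n, p - 1 = n + 1 := ⟨p - 2, by have := hp.two_le; omega⟩
  have hx : (LieAlgebra.ad F L x ^ (n + 1)) x = 0 := by
    rw [pow_succ]; simp
  have hc : (C (LieAlgebra.ad F L x) * X : (Module.End F L)[X]) ^ (n + 1) =
      C (LieAlgebra.ad F L x ^ (n + 1)) * X ^ (n + 1) := by
    rw [(commute_X (C (LieAlgebra.ad F L x))).symm.mul_pow, C_pow]
  simp only [jacobsonTerm, hn, map_zero, add_zero, hc, coeff_C_mul, coeff_X_pow]
  split_ifs
  · rw [mul_one, hx, smul_zero]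
  · simp

theorem jacobsonTerm_mem {p : ℕ} (hp : p.Prime) (I : LieIdeal F L) (x : L) {y : L}
    (hy : y ∈ I) (i : ℕ) : jacobsonTerm p F x y i ∈ I := by
  have h0 : LieSubmodule.Quotient.mk' I y = 0 := by
    simpa using (LieSubmodule.Quotient.mk_eq_zero' (N := I)).2 hy
  have h := map_jacobsonTerm p (LieHom.mk (LieSubmodule.Quotient.mk' I : L →ₗ[F] L ⧸ I)
    (by intro a b; rfl)) x y i
  change LieSubmodule.Quotient.mk' I (jacobsonTerm p F x y i) =
    jacobsonTerm p F (LieSubmodule.Quotient.mk' I x) (LieSubmodule.Quotient.mk' I y) i at h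
  rw [h0, jacobsonTerm_zero_right hp] at h
  exact (LieSubmodule.Quotient.mk_eq_zero' (N := I)).1 h

end Jacobson

section Quotient

variable {p : ℕ} {F L : Type*} [Field F] [LieRing L] [LieAlgebra F L]
  [RestrictedLieAlgebra p F L]

theorem pMap_sub_mem (hp : p.Prime) (I : LieIdeal F L) (hI : ∀ x ∈ I, pMap p F x ∈ I)
    {x y : L} (h : x - y ∈ I) : pMap p F x - pMap p F y ∈ I := by
  have hxy : x = y + (x - y) := by abel
  have := pMap_add (p := p) (F := F) y (x - y)
  rw [← hxy] at this
  rw [this, add_assoc, add_sub_cancel_left]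
  exact add_mem (hI _ h) (sum_mem fun i _ => jacobsonTerm_mem hp I y h i)

/-- The quotient of a restricted Lie algebra by an ideal closed under the `p`-map, with
`(x + I)^[p] = x^[p] + I`. -/
@[reducible] noncomputable def quotient (hp : p.Prime) (I : LieIdeal F L)
    (hI : ∀ x ∈ I, pMap p F x ∈ I) : RestrictedLieAlgebra p F (L ⧸ I) :=
  let π : L →ₗ⁅F⁆ L ⧸ I :=
    LieHom.mk (LieSubmodule.Quotient.mk' I : L →ₗ[F] L ⧸ I) (by intro a b; rfl)
  { pMap := Quotient.map' (s₁ := (I.toSubmodule).quotientRel)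
      (s₂ := (I.toSubmodule).quotientRel) (pMap p F) (by
        intro x y h
        rw [Submodule.quotientRel_def] at h ⊢
        exact pMap_sub_mem hp I hI h)
    pMap_smul := by
      rintro a ⟨x⟩
      exact congrArg π (pMap_smul (p := p) a x)
    ad_pMap := by
      rintro ⟨x⟩
      ext ⟨z⟩
      have key : ∀ n : ℕ, π ((LieAlgebra.ad F L x ^ n) z) =
          (LieAlgebra.ad F (L ⧸ I) (π x) ^ n) (π z) := by
        intro n
        induction n with
        | zero => rfl
        | succ n ih =>
          rw [pow_succ', pow_succ', Module.End.mul_apply, Module.End.mul_apply, ← ih]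
          rfl
      have h := congrArg (fun T => π (T z)) (ad_pMap (p := p) (F := F) x)
      exact h.trans (key p)
    pMap_add := by
      rintro ⟨x⟩ ⟨y⟩
      have h := congrArg π (pMap_add (p := p) (F := F) x y)
      rw [map_add, map_add, map_sum] at h
      simp only [map_jacobsonTerm] at h
      exact h }

end Quotient

section PowerIdeal

variable (p : ℕ) (F L : Type*) [Field F] [LieRing L] [LieAlgebra F L]
  [RestrictedLieAlgebra p F L]

variable {L} in
theorem mem_restrictedClosure {S : Set L} {x : L} : x ∈ restrictedClosure p F S ↔
    ∀ K : LieSubalgebra F L, (S ⊆ K ∧ ∀ y ∈ K, pMap p F y ∈ K) → x ∈ K := by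
  rw [restrictedClosure, ← SetLike.mem_coe, LieSubalgebra.coe_sInf, Set.mem_iInter₂]
  rfl

theorem pMap_mem_restrictedClosure {S : Set L} {x : L} (hx : x ∈ restrictedClosure p F S) :
    pMap p F x ∈ restrictedClosure p F S := by
  rw [mem_restrictedClosure] at hx ⊢
  exact fun K hK => hK.2 _ (hx K hK)

variable {F L} in
theorem lie_mem_gammaThree_of_mem_derived {x : L} (hx : x ∈ derivedIdeal F L) (z : L) :
    ⁅z, x⁆ ∈ gammaThree F L := by
  simp only [gammaThree, LieModule.lowerCentralSeries_succ, LieModule.lowerCentralSeries_zero]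
  exact LieSubmodule.lie_mem_lie (LieSubmodule.mem_top _) hx

variable {F L} in
theorem lie_pMap_mem (hp : p.Prime) (I : LieIdeal F L) {x : L} (hx : ∀ z : L, ⁅x, z⁆ ∈ I)
    (z : L) : ⁅pMap p F x, z⁆ ∈ I := by
  obtain ⟨n, hn⟩ : ∃ n, p = n + 1 := ⟨p - 1, by have := hp.two_le; omega⟩
  have h := congrArg (fun T => T z) (ad_pMap (p := p) (F := F) x)
  simp only [LieAlgebra.ad_apply] at h
  have h2 : (LieAlgebra.ad F L x ^ p) z = ⁅x, (LieAlgebra.ad F L x ^ n) z⁆ := by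
    rw [hn, pow_succ', Module.End.mul_apply, LieAlgebra.ad_apply]
  rw [h, h2]
  exact hx _

variable {F L} in
theorem lie_mem_gammaThree_of_mem_pPower (hp : p.Prime) {x : L}
    (hx : x ∈ pPower p (derivedIdeal F L).toLieSubalgebra) (z : L) :
    ⁅x, z⁆ ∈ gammaThree F L := by
  let K : LieSubalgebra F L :=
    { carrier := {x | ∀ z : L, ⁅x, z⁆ ∈ gammaThree F L}
      add_mem' := fun {a b} ha hb z => by rw [add_lie]; exact add_mem (ha z) (hb z)
      zero_mem' := fun z => by rw [zero_lie]; exact zero_mem _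
      smul_mem' := fun c a ha z => by rw [smul_lie]; exact SMulMemClass.smul_mem c (ha z)
      lie_mem' := fun {a b} ha hb z => by
        rw [lie_lie]; exact sub_mem (ha _) (hb _) }
  have hK : x ∈ K := by
    rw [pPower, mem_restrictedClosure] at hx
    refine hx K ⟨?_, fun a ha => lie_pMap_mem p hp (gammaThree F L) ha⟩
    rintro _ ⟨a, ha, rfl⟩
    refine lie_pMap_mem p hp (gammaThree F L) fun z => ?_
    rw [← lie_skew]
    exact neg_mem (lie_mem_gammaThree_of_mem_derived ha z)
  exact hK z

variable [hp : Fact p.Prime]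

/-- The ideal `L'^p + γ₃(L)` of `L`. -/
def powerGammaIdeal : LieIdeal F L :=
  { toSubmodule := (pPower p (derivedIdeal F L).toLieSubalgebra).toSubmodule ⊔
      (gammaThree F L).toSubmodule
    lie_mem := by
      intro z x hx
      obtain ⟨a, ha, b, hb, rfl⟩ := Submodule.mem_sup.1 hx
      refine Submodule.mem_sup_right ?_
      rw [lie_add, ← lie_skew]
      exact add_mem (neg_mem (lie_mem_gammaThree_of_mem_pPower p hp.out ha z))
        (LieSubmodule.lie_mem _ hb) }

theorem pMap_mem_powerGammaIdeal : ∀ x ∈ powerGammaIdeal p F L,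
    pMap p F x ∈ powerGammaIdeal p F L := by
  intro x hx
  obtain ⟨a, ha, b, hb, rfl⟩ := Submodule.mem_sup.1 hx
  have hb' : b ∈ derivedIdeal F L :=
    LieModule.antitone_lowerCentralSeries F L L (show 1 ≤ 2 by norm_num) hb
  rw [pMap_add (p := p) (F := F)]
  refine add_mem (add_mem (Submodule.mem_sup_left (pMap_mem_restrictedClosure p F L ha))
    (Submodule.mem_sup_left ?_)) (Submodule.mem_sup_right
      (sum_mem fun i _ => jacobsonTerm_mem hp.out (gammaThree F L) a hb i))
  change pMap p F b ∈ pPower p (derivedIdeal F L).toLieSubalgebra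
  rw [pPower, mem_restrictedClosure]
  exact fun K hK => hK.1 ⟨b, hb', rfl⟩

/-- The restricted Lie algebra structure on `L / (L'^p + γ₃(L))`. -/
noncomputable instance : RestrictedLieAlgebra p F (L ⧸ powerGammaIdeal p F L) :=
  quotient hp.out (powerGammaIdeal p F L) (pMap_mem_powerGammaIdeal p F L)

end PowerIdeal

/-- An isomorphism of restricted Lie algebras: an isomorphism of Lie algebras over `F` that
commutes with the `p`-maps. -/
structure RestrictedLieEquiv (p : ℕ) (F L M : Type*) [Field F] [LieRing L] [LieAlgebra F L]
    [RestrictedLieAlgebra p F L] [LieRing M] [LieAlgebra F M]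
    [RestrictedLieAlgebra p F M] extends L ≃ₗ⁅F⁆ M where
  map_pMap : ∀ x : L, toFun (pMap p F x) = pMap p F (toFun x)

end RestrictedLieAlgebra

end

/-! Let `M` be the quotient on the `H` side. It has class at most two and its `p`-map kills `M'`.
The heart of the proof is `IsClassTwo.exists_retraction`: if such an `M` is finite-dimensional and
`p`-nilpotent, then `M → u(M)` has a linear retraction `π` which turns commutators into brackets,
turns `p`-th powers in the augmentation ideal `ω` into values of the `p`-map, and sends `ω²` into
`M'` plus the span of the `p`-powers. Hence `L → u(L) ≅ u(H) → u(M) → M` is a restricted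
homomorphism. Since `ω = L + ω²`, its image generates `M` modulo brackets and `p`-powers, so it is
onto by nilpotency; it also kills `L'^p + γ₃(L)`. Exchanging `L` and `H` gives a surjection the
other way, and equality of dimensions makes the first one an isomorphism.

To build `π`, choose a basis of `M/M'` made of chains `x i, (x i)^[p], ...`; this is where
perfectness enters. On `E = F[X i] ⊕ M'`, with product twisted by `halfBracket`, let `τ : E → M`
send `X i ^ p ^ j` to the `j`-th `p`-power of `x i`, kill the other monomials and fix `M'`. The
required properties of `τ` can be checked on monomials. Then `u(M)` maps to the quotient of `E` by
the largest ideal inside the kernels of `τ` and of the augmentation, and `τ` descends there.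

Nothing is assumed about `H`. Finiteness and `p`-nilpotency of `M` come from `L` through a
commutative algebra containing `M/M'` (`exists_injective_pow_eq`). -/

namespace RestrictedLieAlgebra

attribute [local instance] LieRing.ofAssociativeRing

/-! ### Restricted enveloping algebras and their augmentation -/

section Enveloping

variable (p : ℕ) (F : Type*) {L : Type*} [Field F] [LieRing L] [LieAlgebra F L]
  [RestrictedLieAlgebra p F L]

/-- The canonical map `L → u(L)`. -/
noncomputable def envι : L →ₗ⁅F⁆ RestrictedEnvelopingAlgebra p F L :=
  ((RingQuot.mkAlgHom F (EnvelopingRel p F L)).toLieHom).comp (UniversalEnvelopingAlgebra.ι F)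

theorem envι_pow (x : L) : envι p F x ^ p = envι p F (pMap p F x) := by
  have h := RingQuot.mkAlgHom_rel F (EnvelopingRel.pow_eq (p := p) (F := F) x)
  rw [map_pow] at h
  exact h

theorem envι_pow_pow (k : ℕ) : ∀ x : L,
    envι p F x ^ p ^ k = envι p F ((pMap p F)^[k] x) := by
  induction k with
  | zero => simp
  | succ k ih => intro x; rw [pow_succ', pow_mul, envι_pow, ih, Function.iterate_succ_apply]

variable {p F}

/-- The universal property of `u(L)`. -/
noncomputable def envLift {A : Type*} [Ring A] [Algebra F A] (f : L →ₗ⁅F⁆ A)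
    (hf : ∀ x, f x ^ p = f (pMap p F x)) : RestrictedEnvelopingAlgebra p F L →ₐ[F] A :=
  RingQuot.liftAlgHom F ⟨UniversalEnvelopingAlgebra.lift F f, by
    rintro _ _ ⟨x⟩
    rw [map_pow, UniversalEnvelopingAlgebra.lift_ι_apply,
      UniversalEnvelopingAlgebra.lift_ι_apply, hf]⟩

@[simp]
theorem envLift_ι {A : Type*} [Ring A] [Algebra F A] (f : L →ₗ⁅F⁆ A)
    (hf : ∀ x, f x ^ p = f (pMap p F x)) (x : L) : envLift f hf (envι p F x) = f x := by
  change RingQuot.liftAlgHom F _ (RingQuot.mkAlgHom F _ _) = _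
  rw [RingQuot.liftAlgHom_mkAlgHom_apply]
  exact UniversalEnvelopingAlgebra.lift_ι_apply F f x

theorem env_hom_ext {A : Type*} [Ring A] [Algebra F A]
    {f g : RestrictedEnvelopingAlgebra p F L →ₐ[F] A}
    (h : ∀ x, f (envι p F x) = g (envι p F x)) : f = g := by
  apply RingQuot.ringQuot_ext'
  apply UniversalEnvelopingAlgebra.hom_ext
  ext x
  exact h x

/-- The universal property gives a map from `u(L)` to the subalgebra `S`; followed by the inclusion
it fixes the generators, so it is the identity. -/
theorem env_adjoin_eq_top :
    Algebra.adjoin F (Set.range (envι p F : L → RestrictedEnvelopingAlgebra p F L)) = ⊤ := by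
  set S := Algebra.adjoin F (Set.range (envι p F : L → RestrictedEnvelopingAlgebra p F L))
  have hS : ∀ x : L, envι p F x ∈ S := fun x => Algebra.subset_adjoin ⟨x, rfl⟩
  let f : L →ₗ⁅F⁆ S :=
    { toFun := fun x => ⟨envι p F x, hS x⟩
      map_add' := fun x y => Subtype.ext (map_add _ _ _)
      map_smul' := fun a x => Subtype.ext (map_smul (envι p F) a x)
      map_lie' := fun {x y} => Subtype.ext ((envι p F).map_lie x y) }
  have hf : ∀ x, f x ^ p = f (pMap p F x) := fun x => Subtype.ext (envι_pow p F x)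
  have h : S.val.comp (envLift f hf) = AlgHom.id F _ := env_hom_ext fun x => by
    simp [f]
  rw [eq_top_iff]
  intro u _
  have := congrArg (fun g => g u) h
  simp only [AlgHom.comp_apply, AlgHom.id_apply] at this
  rw [← this]
  exact (envLift f hf u).2

theorem env_induction {C : RestrictedEnvelopingAlgebra p F L → Prop}
    (hι : ∀ x : L, C (envι p F x)) (hF : ∀ a : F, C (algebraMap F _ a))
    (hadd : ∀ u v, C u → C v → C (u + v)) (hmul : ∀ u v, C u → C v → C (u * v))
    (u : RestrictedEnvelopingAlgebra p F L) : C u := by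
  have hu : u ∈ Algebra.adjoin F
      (Set.range (envι p F : L → RestrictedEnvelopingAlgebra p F L)) := by
    rw [env_adjoin_eq_top]; trivial
  induction hu using Algebra.adjoin_induction with
  | mem x hx => obtain ⟨x, rfl⟩ := hx; exact hι x
  | algebraMap a => exact hF a
  | add u v _ _ h1 h2 => exact hadd u v h1 h2
  | mul u v _ _ h1 h2 => exact hmul u v h1 h2

variable [hp : Fact p.Prime]

variable (p F L) in
/-- The augmentation `u(L) → F`. -/
noncomputable def augmentation : RestrictedEnvelopingAlgebra p F L →ₐ[F] F :=
  envLift (0 : L →ₗ⁅F⁆ F) fun x => by simp [hp.out.ne_zero]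

@[simp]
theorem augmentation_ι (x : L) : augmentation p F L (envι p F x) = 0 := by
  simp [augmentation]

/-- The augmentation ideal is spanned by `L` and its own square. -/
theorem exists_eq_ι_add (u : RestrictedEnvelopingAlgebra p F L) :
    ∃ x : L, u - algebraMap F _ (augmentation p F L u) - envι p F x ∈
      Submodule.span F {w | ∃ a b : RestrictedEnvelopingAlgebra p F L,
        augmentation p F L a = 0 ∧ augmentation p F L b = 0 ∧ w = a * b} := by
  induction u using env_induction with
  | hι x => exact ⟨x, by simp⟩
  | hF a => exact ⟨0, by simp⟩
  | hadd u v hu hv =>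
    obtain ⟨x, hx⟩ := hu
    obtain ⟨y, hy⟩ := hv
    refine ⟨x + y, ?_⟩
    convert add_mem hx hy using 1
    simp only [map_add]
    abel
  | hmul u v hu hv =>
    obtain ⟨x, hx⟩ := hu
    obtain ⟨y, hy⟩ := hv
    set a := augmentation p F L u with ha
    set b := augmentation p F L v with hb
    -- From `uv - ab = (u - a)(v - b) + a(v - b) + b(u - a)`.
    refine ⟨a • y + b • x, ?_⟩
    have h1 : (u - algebraMap F _ a) * (v - algebraMap F _ b) ∈
        Submodule.span F {w | ∃ a b : RestrictedEnvelopingAlgebra p F L,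
        augmentation p F L a = 0 ∧ augmentation p F L b = 0 ∧ w = a * b} :=
      Submodule.subset_span ⟨_, _, by simp [ha], by simp [hb], rfl⟩
    convert add_mem h1 (add_mem (Submodule.smul_mem _ a hy) (Submodule.smul_mem _ b hx)) using 1
    simp only [map_add, map_mul, map_smul, ← ha, ← hb, Algebra.smul_def, mul_sub, sub_mul]
    rw [← Algebra.commutes b u, ← Algebra.commutes b ((algebraMap F _) a)]
    abel

/-- If the elements of `L` are nilpotent in `u(L)`, every algebra map `u(L) → F` is the
augmentation. -/
theorem eq_augmentation_of_isPNilpotent (hnil : IsPNilpotent p F L)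
    (f : RestrictedEnvelopingAlgebra p F L →ₐ[F] F) : f = augmentation p F L := by
  obtain ⟨n, hn⟩ := hnil
  refine env_hom_ext fun x => ?_
  have h := congrArg f (envι_pow_pow p F n x)
  rw [hn, map_zero, map_zero, map_pow] at h
  rw [augmentation_ι]
  exact pow_eq_zero_iff (pow_ne_zero _ hp.out.ne_zero) |>.1 h

end Enveloping

end RestrictedLieAlgebra

/-! ### Commutative envelopes of abelian restricted Lie algebras -/

section AbelianPBW

variable {p : ℕ} {F : Type*} [Field F] {V : Type*} [AddCommGroup V] [Module F V]

/-- The coordinate of the monomial with exponent `α` along the linear part, modulo the relations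
`X b ^ p = ∑ c, a b c * X c`. -/
noncomputable def linearPart {B : Type*} (p : ℕ) (v : B → V) (a : B → B →₀ F)
    (hp : 1 < p) (α : B →₀ ℕ) : V :=
  open Classical in
  if h : ∃ b, p ≤ α b then
    (a h.choose).sum fun c t =>
      t • linearPart p v a hp (α - Finsupp.single h.choose p + Finsupp.single c 1)
  else if h : ∃ c, α = Finsupp.single c 1 then v h.choose else 0
termination_by α.degree
decreasing_by
  have h1 : Finsupp.single h.choose p ≤ α := by
    rw [Finsupp.single_le_iff]; exact h.choose_spec
  have h2 : (α - Finsupp.single h.choose p).degree + p = α.degree := by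
    conv_rhs => rw [← tsub_add_cancel_of_le h1]
    simp
  rw [map_add, Finsupp.degree_single]
  omega

theorem linearPart_single {B : Type*} (v : B → V) (a : B → B →₀ F) (hp : 1 < p) (c : B) :
    linearPart p v a hp (Finsupp.single c 1) = v c := by
  classical
  rw [linearPart, dif_neg, dif_pos ⟨c, rfl⟩]
  · have h : ∃ c', Finsupp.single c 1 = Finsupp.single c' 1 := ⟨c, rfl⟩
    rw [← (Finsupp.single_left_injective one_ne_zero) h.choose_spec]
  · rintro ⟨b, hb⟩
    rw [Finsupp.single_apply] at hb
    split_ifs at hb <;> omega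

/-- This is confluence: `linearPart` rewrites at an arbitrarily chosen index, and the choice is
immaterial. If the chosen `b'` differs from `b`, both rewritings can be performed, and induction on
the degree turns the claim into an exchange of two sums. -/
theorem linearPart_add_single {B : Type*} (v : B → V) (a : B → B →₀ F) (hp : 1 < p) :
    ∀ (n : ℕ) (α : B →₀ ℕ), α.degree = n → ∀ b : B,
    linearPart p v a hp (α + Finsupp.single b p) =
      (a b).sum fun c t => t • linearPart p v a hp (α + Finsupp.single c 1) := by
  intro n
  induction n using Nat.strong_induction_on with
  | _ n ih =>
    intro α hα b
    have h : ∃ b', p ≤ (α + Finsupp.single b p) b' := ⟨b, by simp⟩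
    obtain ⟨b', hb', hle, hrec⟩ : ∃ b', b' = h.choose ∧ p ≤ (α + Finsupp.single b p) b' ∧
        linearPart p v a hp (α + Finsupp.single b p) = (a b').sum fun c t => t •
          linearPart p v a hp (α + Finsupp.single b p - Finsupp.single b' p +
            Finsupp.single c 1) := by
      refine ⟨h.choose, rfl, h.choose_spec, ?_⟩
      rw [linearPart, dif_pos h]
    clear hb'
    rw [hrec]
    by_cases hbb : b' = b
    · subst hbb
      simp
    have hle' : Finsupp.single b' p ≤ α := by
      rw [Finsupp.single_le_iff]
      simpa [Finsupp.single_apply, Ne.symm hbb] using hle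
    obtain ⟨β, rfl⟩ : ∃ β, α = β + Finsupp.single b' p :=
      ⟨α - Finsupp.single b' p, (tsub_add_cancel_of_le hle').symm⟩
    have hdeg : ∀ c : B, (β + Finsupp.single c 1).degree < n := by
      intro c
      rw [← hα]
      simp only [map_add, Finsupp.degree_single]
      omega
    have e1 : ∀ c, β + Finsupp.single b' p + Finsupp.single b p - Finsupp.single b' p +
        Finsupp.single c 1 = (β + Finsupp.single c 1) + Finsupp.single b p := by
      intro c
      rw [add_right_comm β, add_tsub_cancel_right, add_right_comm]
    have e2 : ∀ c, β + Finsupp.single b' p + Finsupp.single c 1 =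
        (β + Finsupp.single c 1) + Finsupp.single b' p := fun c => add_right_comm _ _ _
    simp only [e1, e2, ih _ (hdeg _) _ rfl, Finsupp.sum, Finset.smul_sum]
    rw [Finset.sum_comm]
    refine Finset.sum_congr rfl fun d _ => Finset.sum_congr rfl fun c _ => ?_
    rw [smul_comm, add_right_comm]

open MvPolynomial in
/-- An abelian restricted Lie algebra embeds into a commutative algebra in such a way that the
`p`-map becomes the `p`-th power. -/
theorem exists_injective_pow_eq [hp : Fact p.Prime] [CharP F p] (q : V →ₛₗ[frobenius F p] V) :
    ∃ (B : Set V) (I : Ideal (MvPolynomial B F)) (g : V →ₗ[F] MvPolynomial B F ⧸ I),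
      Function.Injective g ∧ ∀ v, g v ^ p = g (q v) := by
  let bs := Module.Basis.ofVectorSpace F V
  let B := Module.Basis.ofVectorSpaceIndex F V
  let a : B → B →₀ F := fun b => bs.repr (q (bs b))
  let lin : (B →₀ F) →ₗ[F] MvPolynomial B F := Finsupp.linearCombination F X
  -- `R` reads off the linear part of a normal form. It kills `I` and recovers a vector from its
  -- linear form, which makes `g` injective.
  let R : MvPolynomial B F →ₗ[F] V :=
    (basisMonomials B F).constr F (linearPart p bs a hp.out.one_lt)
  have hR : ∀ α, R (monomial α 1) = linearPart p bs a hp.out.one_lt α := fun α => by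
    have := (basisMonomials B F).constr_basis F (linearPart p bs a hp.out.one_lt) α
    rwa [coe_basisMonomials] at this
  let I : Ideal (MvPolynomial B F) := Ideal.span (Set.range fun b => X b ^ p - lin (a b))
  have hmon : ∀ α b, R (monomial α 1 * (X b ^ p - lin (a b))) = 0 := by
    intro α b
    rw [mul_sub, map_sub, X_pow_eq_monomial, monomial_mul, one_mul, hR,
      linearPart_add_single _ _ _ _ _ rfl, sub_eq_zero]
    simp only [lin, Finsupp.linearCombination_apply, Finsupp.sum, Finset.mul_sum, map_sum]
    refine Finset.sum_congr rfl fun c _ => ?_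
    rw [mul_smul_comm, map_smul, X, monomial_mul, one_mul, hR]
  have hI : ∀ f ∈ I, ∀ h, R (h * f) = 0 := by
    intro f hf
    induction hf using Submodule.span_induction with
    | mem f hf =>
      obtain ⟨b, rfl⟩ := hf
      intro h
      induction h using MvPolynomial.induction_on' with
      | monomial α r =>
        rw [← mul_one r, ← smul_eq_mul (a := r), ← smul_monomial, smul_mul_assoc, map_smul, hmon,
          smul_zero]
      | add h k h1 h2 => rw [add_mul, map_add, h1, h2, add_zero]
    | zero => simp
    | add f g _ _ hf hg => intro h; rw [mul_add, map_add, hf, hg, add_zero]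
    | smul k f _ hf => intro h; rw [smul_eq_mul, ← mul_assoc, hf]
  let g : V →ₗ[F] MvPolynomial B F ⧸ I :=
    ((Ideal.Quotient.mkₐ F I).toLinearMap ∘ₗ lin) ∘ₗ bs.repr.toLinearMap
  have hg : ∀ v, g v = Ideal.Quotient.mk I (lin (bs.repr v)) := fun v => rfl
  have hRl : ∀ v, R (lin (bs.repr v)) = v := by
    intro v
    conv_rhs => rw [← bs.linearCombination_repr v]
    simp only [lin, Finsupp.linearCombination_apply, Finsupp.sum, map_sum, map_smul]
    refine Finset.sum_congr rfl fun c _ => ?_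
    rw [X, hR, linearPart_single]
  refine ⟨B, I, g, ?_, ?_⟩
  · rw [injective_iff_map_eq_zero]
    intro v hv
    rw [hg, Ideal.Quotient.eq_zero_iff_mem] at hv
    rw [← hRl v, ← one_mul (lin _), hI _ hv]
  · intro v
    induction bs.mem_span v using Submodule.span_induction with
    | mem v hv =>
      obtain ⟨b, rfl⟩ := hv
      rw [hg, hg, ← map_pow, Ideal.Quotient.eq, bs.repr_self]
      simp only [lin, Finsupp.linearCombination_single, one_smul]
      exact Ideal.subset_span ⟨b, rfl⟩
    | zero => simp [hp.out.ne_zero]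
    | add v w _ _ hv hw =>
      rw [map_add q, map_add g (q v), ← hv, ← hw]
      rw [hg, hg, hg, map_add bs.repr, map_add lin, ← RingHom.map_pow, ← RingHom.map_pow,
        ← RingHom.map_pow, add_pow_char, RingHom.map_add]
    | smul r v _ hv =>
      rw [map_smul, smul_pow, hv, LinearMap.map_smulₛₗ, map_smul]
      rfl

end AbelianPBW

/-! ### Jordan chains for nilpotent Frobenius-semilinear maps -/

section SemilinearNilpotent

variable {p : ℕ} {F : Type*} [Field F] [hp : Fact p.Prime] [CharP F p] [PerfectField F]

/-- A nilpotent Frobenius-semilinear endomorphism of a finite-dimensional space over a perfect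
field has a basis of Jordan chains. -/
theorem exists_jordan_chains : ∀ (d : ℕ) {V : Type*} [AddCommGroup V] [Module F V]
    [FiniteDimensional F V] (q : V →ₛₗ[frobenius F p] V) (N : ℕ) (_ : ∀ v, q^[N] v = 0)
    (_ : Module.finrank F V = d),
    ∃ (ι : Type) (_ : Fintype ι) (n : ι → ℕ) (x : ι → V)
      (b : Module.Basis (Σ i, Fin (n i)) F V), (∀ i, 0 < n i) ∧
      (∀ s, b s = q^[s.2] (x s.1)) ∧ ∀ i, q^[n i] (x i) = 0 := by
  intro d
  induction d using Nat.strong_induction_on with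
  | _ d ih =>
    intro V _ _ _ q N hN hd
    -- Perfectness makes the range of `q` a subspace. The induction passes to this range, which is
    -- proper because `q` is nilpotent.
    have : RingHomSurjective (frobenius F p) := ⟨(bijective_frobenius F p).2⟩
    by_cases hV : Subsingleton V
    · refine ⟨Empty, inferInstance, fun e => e.elim, fun e => e.elim,
        Module.Basis.empty V, fun e => e.elim, fun s => s.1.elim, fun e => e.elim⟩
    let W := LinearMap.range q
    have hWV : W ≠ ⊤ := by
      intro htop
      have hs : Function.Surjective q := LinearMap.range_eq_top.1 htop
      have hs' : Function.Surjective (q^[N]) := hs.iterate N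
      refine hV ⟨fun v w => ?_⟩
      obtain ⟨v, rfl⟩ := hs' v
      obtain ⟨w, rfl⟩ := hs' w
      rw [hN, hN]
    let qW : W →ₛₗ[frobenius F p] W :=
      (q.comp W.subtype).codRestrict W fun w => LinearMap.mem_range_self _ _
    have hqW : ∀ (k : ℕ) (w : W), ((qW^[k] w : W) : V) = q^[k] w := by
      intro k
      induction k with
      | zero => intro w; rfl
      | succ k ih => intro w; rw [Function.iterate_succ_apply, ih]; rfl
    obtain ⟨ι, _, n, y, b, hn, hb, hy⟩ := ih _ (hd ▸ Submodule.finrank_lt hWV) qW N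
      (fun w => Subtype.ext (by rw [hqW, hN]; rfl)) rfl
    -- Preimages of the heads lengthen each chain of the range by one step.
    choose x hx using fun i => LinearMap.mem_range.1 (y i).2
    have hqx : ∀ i k, q^[k + 1] (x i) = (qW^[k] (y i) : W) := by
      intro i k
      rw [Function.iterate_succ_apply, hx, hqW]
    have hqx0 : ∀ i, q^[n i + 1] (x i) = 0 := fun i => by rw [hqx, hy]; rfl
    let K := LinearMap.ker q
    -- The chain ends lie in the kernel and are independent; the vectors completing them to a basis
    -- of the kernel become new chains of length one.
    let u : ι → K := fun i => ⟨q^[n i] (x i), by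
      have := hqx0 i
      rwa [Function.iterate_succ_apply'] at this⟩
    have hu : LinearIndependent F u := by
      have h1 : LinearIndependent F fun i : ι => b ⟨i, ⟨n i - 1, by have := hn i; omega⟩⟩ :=
        b.linearIndependent.comp (fun i => ⟨i, ⟨n i - 1, by have := hn i; omega⟩⟩)
          fun i j h => (Sigma.mk.inj_iff.1 h).1
      refine LinearIndependent.of_comp K.subtype ?_
      have h2 := h1.map' W.subtype (Submodule.ker_subtype W)
      have h3 : K.subtype ∘ u =
          W.subtype ∘ fun i => b ⟨i, ⟨n i - 1, by have := hn i; omega⟩⟩ := funext fun i => ?_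
      · rw [h3]
        exact h2
      obtain ⟨m, hm⟩ : ∃ m, n i = m + 1 := ⟨n i - 1, by have := hn i; omega⟩
      simp only [Function.comp_apply, Submodule.subtype_apply, hb, u, hm, hqx, Nat.add_sub_cancel]
    let c := Module.Basis.sumExtend hu
    have hcl : ∀ i, c (Sum.inl i) = u i := fun i => by
      simp only [c, Module.Basis.sumExtend, Module.Basis.reindex_apply, Module.Basis.coe_extend]
      rfl
    let κ := Module.Basis.sumExtendIndex hu
    have : Fintype κ :=
      have : Fintype (ι ⊕ κ) := FiniteDimensional.fintypeBasisIndex c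
      Fintype.ofInjective (Sum.inr : κ → ι ⊕ κ) Sum.inr_injective
    let e := Fintype.equivFin κ
    let n' : ι ⊕ Fin (Fintype.card κ) → ℕ := Sum.elim (fun i => n i + 1) fun _ => 1
    let x' : ι ⊕ Fin (Fintype.card κ) → V := Sum.elim x fun l => (c (Sum.inr (e.symm l)) : V)
    let w : (Σ i, Fin (n' i)) → V := fun s => q^[s.2] (x' s.1)
    have hsum : ∀ g : (Σ i, Fin (n' i)) → F, ∑ s, g s • w s =
        ∑ i, (∑ j : Fin (n i), g ⟨Sum.inl i, Fin.castSucc j⟩ • q^[j] (x i) +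
          g ⟨Sum.inl i, Fin.last _⟩ • (u i : V)) +
        ∑ l, g ⟨Sum.inr l, (0 : Fin 1)⟩ • (c (Sum.inr (e.symm l)) : V) := by
      intro g
      rw [Fintype.sum_sigma, Fintype.sum_sum_type]
      congr 1
      · refine Finset.sum_congr rfl fun i _ => ?_
        exact Fin.sum_univ_castSucc (n := n i) _
      · refine Finset.sum_congr rfl fun l _ => ?_
        exact Fin.sum_univ_one _
    have hker : ∀ k : K, q k = 0 := fun k => k.2
    -- Applying `q` kills the chain ends and shifts the other vectors onto the basis of the range.
    -- Independence and spanning thus both split into a statement in the range and one in the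
    -- kernel.
    have hqsum : ∀ g : (Σ i, Fin (n' i)) → F, q (∑ s, g s • w s) =
        ((∑ s : (Σ i, Fin (n i)), g ⟨Sum.inl s.1, Fin.castSucc s.2⟩ ^ p • b s : W) : V) := by
      intro g
      rw [hsum, map_add, map_sum, map_sum, Fintype.sum_sigma]
      simp only [map_add, map_sum, LinearMap.map_smulₛₗ, hker, smul_zero, add_zero,
        Finset.sum_const_zero, Submodule.coe_sum, Submodule.coe_smul, hb, hqW, hx,
        ← Function.iterate_succ_apply', Function.iterate_succ_apply, frobenius_def]
    have hli : LinearIndependent F w := by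
      rw [Fintype.linearIndependent_iff]
      intro g hg
      have h1 := hqsum g
      rw [hg, map_zero] at h1
      have h2 := Fintype.linearIndependent_iff.1 b.linearIndependent _ (Subtype.ext h1.symm)
      have h3 : ∀ i (j : Fin (n i)), g ⟨Sum.inl i, Fin.castSucc j⟩ = 0 := fun i j =>
        pow_eq_zero_iff hp.out.ne_zero |>.1 (h2 ⟨i, j⟩)
      rw [hsum] at hg
      simp only [h3, zero_smul, Finset.sum_const_zero, zero_add] at hg
      let gl : ι → F := fun i => g ⟨Sum.inl i, Fin.last _⟩
      let gr : Fin (Fintype.card κ) → F := fun l => g ⟨Sum.inr l, (0 : Fin 1)⟩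
      change ∑ i, gl i • (u i : V) + ∑ l, gr l • (c (Sum.inr (e.symm l)) : V) = 0 at hg
      have h4 : ∑ t : ι ⊕ κ, (Sum.elim gl (gr ∘ e) t : F) • c t = 0 := by
        apply Subtype.ext
        rw [Fintype.sum_sum_type, ← e.symm.sum_comp]
        simpa [hcl] using hg
      have h5 := Fintype.linearIndependent_iff.1 c.linearIndependent _ h4
      rintro ⟨i | l, j⟩
      · induction j using Fin.lastCases with
        | last => exact h5 (Sum.inl i)
        | cast j => exact h3 i j
      · have := h5 (Sum.inr (e.symm l))
        simp only [Sum.elim_inr, Function.comp_apply, Equiv.apply_symm_apply] at this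
        rw [Subsingleton.elim (α := Fin 1) j 0]
        exact this
    have hsp : ⊤ ≤ Submodule.span F (Set.range w) := by
      intro v _
      let r : W := ⟨q v, LinearMap.mem_range_self _ _⟩
      -- The coefficients are `p`-th roots of the coordinates of `q v`, so that the combination
      -- differs from `v` by a kernel vector.
      let g : (Σ i, Fin (n' i)) → F := fun s => match s with
        | ⟨Sum.inl i, j⟩ => if h : (j : ℕ) < n i then
            (frobeniusEquiv F p).symm (b.repr r ⟨i, ⟨j, h⟩⟩) else 0
        | ⟨Sum.inr l, _⟩ => 0
      have h1 : q (∑ s, g s • w s) = q v := by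
        rw [hqsum]
        have : ∀ s : (Σ i, Fin (n i)), g ⟨Sum.inl s.1, Fin.castSucc s.2⟩ ^ p = b.repr r s := by
          intro s
          simp [g]
        simp only [this, b.sum_repr]
        rfl
      have hw0 : ∀ t : ι ⊕ κ, (c t : V) ∈ Submodule.span F (Set.range w) := by
        rintro (i | l)
        · rw [hcl]
          exact Submodule.subset_span ⟨⟨Sum.inl i, Fin.last (n i)⟩, rfl⟩
        · refine Submodule.subset_span ⟨⟨Sum.inr (e l), (0 : Fin 1)⟩, ?_⟩
          simp [w, x']
      have h2 : v - ∑ s, g s • w s ∈ Submodule.span F (Set.range w) := by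
        let k : K := ⟨v - ∑ s, g s • w s, by
          rw [LinearMap.mem_ker, map_sub, h1, sub_self]⟩
        change (k : V) ∈ _
        rw [← c.sum_repr k, Submodule.coe_sum]
        exact sum_mem fun t _ => Submodule.smul_mem _ _ (hw0 t)
      rw [← sub_add_cancel v (∑ s, g s • w s)]
      exact add_mem h2 (sum_mem fun s _ => Submodule.smul_mem _ _
        (Submodule.subset_span ⟨s, rfl⟩))
    refine ⟨ι ⊕ Fin (Fintype.card κ), inferInstance, n', x', Module.Basis.mk hli hsp, ?_, ?_, ?_⟩
    · rintro (i | l) <;> simp [n']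
    · intro s
      rw [Module.Basis.mk_apply]
    · rintro (i | l)
      · exact hqx0 i
      · exact hker _

end SemilinearNilpotent

/-! ### Extensions of a commutative algebra by a biderivation -/

section BiderivationExtension

variable {F P Z : Type*} [Field F] [CommRing P] [Algebra F P] [AddCommGroup Z] [Module F Z]

/-- A bilinear map on an augmented commutative algebra which is a derivation in each variable, the
values being acted upon through the augmentation. -/
structure AugBiderivation (ε : P →ₐ[F] F) (Z : Type*) [AddCommGroup Z] [Module F Z] where
  /-- The underlying bilinear map. -/
  form : P →ₗ[F] P →ₗ[F] Z
  mul_left : ∀ a b c, form (a * b) c = ε a • form b c + ε b • form a c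
  mul_right : ∀ a b c, form a (b * c) = ε b • form a c + ε c • form a b

/-- The extension of `P` by the trivial bimodule `Z` with cocycle a biderivation. -/
def BiderivationExt {ε : P →ₐ[F] F} (_ : AugBiderivation ε Z) : Type _ := P × Z

namespace BiderivationExt

variable {ε : P →ₐ[F] F} {D : AugBiderivation ε Z}

instance : AddCommGroup (BiderivationExt D) := inferInstanceAs (AddCommGroup (P × Z))
instance : Module F (BiderivationExt D) := inferInstanceAs (Module F (P × Z))

instance : Mul (BiderivationExt D) :=
  ⟨fun u v => (u.1 * v.1, ε u.1 • v.2 + ε v.1 • u.2 + D.form u.1 v.1)⟩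
instance : One (BiderivationExt D) := ⟨((1 : P), (0 : Z))⟩

variable (D) in
/-- The element of the extension with given components. -/
def mk (c : P) (z : Z) : BiderivationExt D := (c, z)

@[ext] theorem ext {u v : BiderivationExt D} (h1 : u.1 = v.1) (h2 : u.2 = v.2) : u = v :=
  Prod.ext h1 h2

@[simp] theorem mk_fst (c : P) (z : Z) : (mk D c z).1 = c := rfl
@[simp] theorem mk_snd (c : P) (z : Z) : (mk D c z).2 = z := rfl
@[simp] theorem zero_fst : (0 : BiderivationExt D).1 = 0 := rfl
@[simp] theorem zero_snd : (0 : BiderivationExt D).2 = 0 := rfl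
@[simp] theorem one_fst : (1 : BiderivationExt D).1 = 1 := rfl
@[simp] theorem one_snd : (1 : BiderivationExt D).2 = 0 := rfl
@[simp] theorem add_fst (u v : BiderivationExt D) : (u + v).1 = u.1 + v.1 := rfl
@[simp] theorem add_snd (u v : BiderivationExt D) : (u + v).2 = u.2 + v.2 := rfl
@[simp] theorem smul_fst (a : F) (u : BiderivationExt D) : (a • u).1 = a • u.1 := rfl
@[simp] theorem smul_snd (a : F) (u : BiderivationExt D) : (a • u).2 = a • u.2 := rfl
@[simp] theorem mul_fst (u v : BiderivationExt D) : (u * v).1 = u.1 * v.1 := rfl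
@[simp] theorem mul_snd (u v : BiderivationExt D) :
    (u * v).2 = ε u.1 • v.2 + ε v.1 • u.2 + D.form u.1 v.1 := rfl

theorem form_one_left (c : P) : D.form 1 c = 0 := by
  have := D.mul_left 1 1 c
  simpa using this

theorem form_one_right (c : P) : D.form c 1 = 0 := by
  have := D.mul_right c 1 1
  simpa using this

instance : Ring (BiderivationExt D) :=
  { (inferInstance : AddCommGroup (BiderivationExt D)) with
    mul := (· * ·)
    one := 1
    left_distrib := fun u v w => by
      ext
      · simp [mul_add]
      · simp only [mul_snd, add_fst, add_snd, map_add, smul_add, add_smul]; abel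
    right_distrib := fun u v w => by
      ext
      · simp [add_mul]
      · simp only [mul_snd, add_fst, add_snd, map_add, smul_add, add_smul,
          LinearMap.add_apply]; abel
    zero_mul := fun u => by ext <;> simp
    mul_zero := fun u => by ext <;> simp
    -- In the second component this is the Hochschild cocycle identity, a consequence of the two
    -- Leibniz rules.
    mul_assoc := fun u v w => by
      ext
      · simp [mul_assoc]
      · simp only [mul_snd, mul_fst, map_mul, smul_add, D.mul_left, D.mul_right, smul_smul]
        rw [mul_comm (ε w.1) (ε u.1), mul_comm (ε w.1) (ε v.1)]
        abel
    one_mul := fun u => by ext <;> simp [form_one_left]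
    mul_one := fun u => by ext <;> simp [form_one_right] }

instance : Algebra F (BiderivationExt D) :=
  Algebra.ofModule
    (fun a u v => by
      ext
      · simp
      · simp [smul_add, smul_smul, mul_comm])
    (fun a u v => by
      ext
      · simp
      · simp [smul_add, smul_smul, mul_comm])

@[simp] theorem neg_fst (u : BiderivationExt D) : (-u).1 = -u.1 := rfl
@[simp] theorem neg_snd (u : BiderivationExt D) : (-u).2 = -u.2 := rfl
@[simp] theorem sub_fst (u v : BiderivationExt D) : (u - v).1 = u.1 - v.1 := by
  simp [sub_eq_add_neg]
@[simp] theorem sub_snd (u v : BiderivationExt D) : (u - v).2 = u.2 - v.2 := by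
  simp [sub_eq_add_neg]

variable (D) in
/-- The augmentation of the extension. -/
def aug : BiderivationExt D →ₐ[F] F :=
  AlgHom.ofLinearMap
    { toFun := fun u => ε u.1
      map_add' := fun u v => by simp
      map_smul' := fun a u => by simp }
    (by simp) (fun u v => by simp)

@[simp] theorem aug_apply (u : BiderivationExt D) : aug D u = ε u.1 := rfl

theorem commutator_eq (u v : BiderivationExt D) :
    u * v - v * u = mk D 0 (D.form u.1 v.1 - D.form v.1 u.1) := by
  ext
  · simp [mul_comm]
  · simp only [sub_snd, mul_snd, mk_snd]
    abel

/-- In the augmentation ideal a product involves only first components, and by the Leibniz rule the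
form vanishes on `(a, a ^ k)` for `k ≥ 2`. Only the square keeps a second component. -/
theorem pow_add_two {u : BiderivationExt D} (hu : ε u.1 = 0) (k : ℕ) :
    u ^ (k + 2) = mk D (u.1 ^ (k + 2)) (if k = 0 then D.form u.1 u.1 else 0) := by
  induction k with
  | zero => rw [zero_add, pow_two]; ext <;> simp [hu, pow_two]
  | succ k ih =>
    rw [show k + 1 + 2 = (k + 2) + 1 from rfl, pow_succ', ih]
    ext
    · simp [pow_succ']
    · simp [hu, pow_succ' u.1, D.mul_right]

theorem pow_prime {p : ℕ} (hp : p.Prime) {u : BiderivationExt D} (hu : ε u.1 = 0) :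
    u ^ p = mk D (u.1 ^ p) (if p = 2 then D.form u.1 u.1 else 0) := by
  obtain ⟨k, rfl⟩ : ∃ k, p = k + 2 := ⟨p - 2, by have := hp.two_le; omega⟩
  rw [pow_add_two hu]
  simp

/-- The defect of additivity has the same shape as that of the `p`-map in `IsClassTwo.pMap_add_eq`:
nothing for odd `p`, one commutator for `p = 2`. -/
theorem add_pow_prime {p : ℕ} [hp : Fact p.Prime] [CharP F p] [CharP P p]
    {u v : BiderivationExt D} (hu : ε u.1 = 0) (hv : ε v.1 = 0) :
    (u + v) ^ p = u ^ p + v ^ p + if p = 2 then v * u - u * v else 0 := by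
  rw [pow_prime hp.out hu, pow_prime hp.out hv, pow_prime hp.out (by simp [hu, hv])]
  split_ifs with h2
  · subst h2
    rw [commutator_eq]
    ext
    · simp [add_pow_char]
    · have h : ∀ z : Z, -z = z := fun z => by
        rw [← neg_one_smul F z, CharTwo.neg_eq, one_smul]
      simp only [mk_snd, add_fst, map_add, LinearMap.add_apply, add_snd, sub_eq_add_neg, h]
      abel
  · ext
    · simp [add_pow_char]
    · simp

end BiderivationExt

end BiderivationExtension

namespace RestrictedLieAlgebra

/-! ### Restricted Lie algebras of class two -/

section ClassTwo

/-- The span of all brackets. -/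
def bracketSpan (F M : Type*) [Field F] [LieRing M] [LieAlgebra F M] : Submodule F M :=
  Submodule.span F {m | ∃ x y : M, ⁅x, y⁆ = m}

theorem lie_mem_bracketSpan {F M : Type*} [Field F] [LieRing M] [LieAlgebra F M] (x y : M) :
    ⁅x, y⁆ ∈ bracketSpan F M := Submodule.subset_span ⟨x, y, rfl⟩

/-- Restricted Lie algebras of nilpotency class at most two whose `p`-map kills the derived
subalgebra. -/
structure IsClassTwo (p : ℕ) (F M : Type*) [Field F] [LieRing M] [LieAlgebra F M]
    [RestrictedLieAlgebra p F M] : Prop where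
  lie_lie_eq_zero : ∀ x y z : M, ⁅x, ⁅y, z⁆⁆ = 0
  pMap_eq_zero : ∀ z ∈ bracketSpan F M, pMap p F z = 0

theorem pMap_zero {p : ℕ} {F M : Type*} [Field F] [LieRing M] [LieAlgebra F M]
    [RestrictedLieAlgebra p F M] [hp : Fact p.Prime] : pMap p F (0 : M) = 0 := by
  have := pMap_smul (p := p) (0 : F) (0 : M)
  rwa [zero_smul, zero_pow hp.out.ne_zero, zero_smul] at this

namespace IsClassTwo

variable {p : ℕ} {F M : Type*} [Field F] [LieRing M] [LieAlgebra F M]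
  [RestrictedLieAlgebra p F M]

theorem lie_mem_right (hM : IsClassTwo p F M) {z : M} (hz : z ∈ bracketSpan F M) (x : M) :
    ⁅x, z⁆ = 0 := by
  induction hz using Submodule.span_induction with
  | mem z hz => obtain ⟨a, b, rfl⟩ := hz; exact hM.lie_lie_eq_zero _ _ _
  | zero => simp
  | add a b _ _ ha hb => rw [lie_add, ha, hb, add_zero]
  | smul t a _ ha => rw [lie_smul, ha, smul_zero]

theorem lie_mem_left (hM : IsClassTwo p F M) {z : M} (hz : z ∈ bracketSpan F M) (x : M) :
    ⁅z, x⁆ = 0 := by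
  rw [← lie_skew, hM.lie_mem_right hz, neg_zero]

open Polynomial in
theorem coeff_pow_eq_zero (hM : IsClassTwo p F M) (x y z : M) (n k : ℕ) :
    ((((C (LieAlgebra.ad F M x) * X + C (LieAlgebra.ad F M y) : (Module.End F M)[X]) ^
      (n + 2)).coeff k) z) = 0 := by
  rw [pow_succ', pow_succ']
  simp only [add_mul, mul_add, mul_assoc, coeff_add, coeff_C_mul]
  rcases k with _ | _ | k <;>
  simp [mul_coeff_zero, hM.lie_lie_eq_zero, ← mul_assoc X (C _), (commute_X _).eq,
    mul_assoc]

variable [hp : Fact p.Prime]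

theorem pMap_lie (hM : IsClassTwo p F M) (x y : M) : ⁅pMap p F x, y⁆ = 0 := by
  have h := congrArg (fun T => T y) (ad_pMap (p := p) (F := F) x)
  obtain ⟨k, hk⟩ : ∃ k, p = k + 2 := ⟨p - 2, by have := hp.out.two_le; omega⟩
  have h2 : (LieAlgebra.ad F M x ^ p) y = 0 := by
    rw [hk, pow_succ', pow_succ', Module.End.mul_apply, Module.End.mul_apply,
      LieAlgebra.ad_apply, LieAlgebra.ad_apply, hM.lie_lie_eq_zero]
  rw [h2, LieAlgebra.ad_apply] at h
  exact h

/-- A Jacobson term is a bracket of length `p`, so in class two it vanishes for `p > 2`; for `p = 2`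
the only term is `⁅y, x⁆`. -/
theorem pMap_add_eq (hM : IsClassTwo p F M) (x y : M) :
    pMap p F (x + y) = pMap p F x + pMap p F y + if p = 2 then ⁅y, x⁆ else 0 := by
  rw [pMap_add]
  congr 1
  split_ifs with h2
  · subst h2
    rw [show Finset.Ico 1 2 = {1} from rfl, Finset.sum_singleton, jacobsonTerm]
    simp
  · obtain ⟨k, hk⟩ : ∃ k, p - 1 = k + 2 := ⟨p - 3, by have := hp.out.two_le; omega⟩
    refine Finset.sum_eq_zero fun i _ => ?_
    rw [jacobsonTerm, hk, hM.coeff_pow_eq_zero, smul_zero]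

theorem pMap_add_sub_mem (hM : IsClassTwo p F M) (x y : M) :
    pMap p F (x + y) - (pMap p F x + pMap p F y) ∈ bracketSpan F M := by
  rw [hM.pMap_add_eq, add_sub_cancel_left]
  split_ifs
  · exact lie_mem_bracketSpan _ _
  · exact zero_mem _

/-- The Frobenius-semilinear map induced by the `p`-map on the abelianization. -/
noncomputable def abelianPMap [CharP F p] (hM : IsClassTwo p F M) :
    (M ⧸ bracketSpan F M) →ₛₗ[frobenius F p] (M ⧸ bracketSpan F M) :=
  (bracketSpan F M).liftQ
    { toFun := fun x => (bracketSpan F M).mkQ (pMap p F x)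
      map_add' := fun x y => by
        rw [← map_add, ← sub_eq_zero, ← map_sub]
        exact (Submodule.Quotient.mk_eq_zero _).2 (hM.pMap_add_sub_mem x y)
      map_smul' := fun a x => by rw [pMap_smul, map_smul]; rfl }
    (fun z hz => by
      rw [LinearMap.mem_ker, LinearMap.coe_mk, AddHom.coe_mk, hM.pMap_eq_zero z hz, map_zero])

theorem abelianPMap_mkQ [CharP F p] (hM : IsClassTwo p F M) (x : M) :
    hM.abelianPMap ((bracketSpan F M).mkQ x) = (bracketSpan F M).mkQ (pMap p F x) := rfl

theorem abelianPMap_iterate [CharP F p] (hM : IsClassTwo p F M) (k : ℕ) : ∀ x : M,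
    hM.abelianPMap^[k] ((bracketSpan F M).mkQ x) =
      (bracketSpan F M).mkQ ((pMap p F)^[k] x) := by
  induction k with
  | zero => intro x; rfl
  | succ k ih =>
    intro x
    rw [Function.iterate_succ_apply, Function.iterate_succ_apply, abelianPMap_mkQ, ih]

end IsClassTwo

end ClassTwo

attribute [local instance] LieRing.ofAssociativeRing

/-! ### The polynomial model and its projection to `M` -/

section Model

open MvPolynomial

variable {p : ℕ} {F M : Type*} [Field F] [LieRing M] [LieAlgebra F M] [RestrictedLieAlgebra p F M]
  {ι : Type*}

/-- The linear coefficient is a partial derivative evaluated at zero, hence a derivation over the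
augmentation. -/
theorem coeff_single_one_mul (i : ι) (a b : MvPolynomial ι F) :
    coeff (Finsupp.single i 1) (a * b) = constantCoeff a * coeff (Finsupp.single i 1) b +
      constantCoeff b * coeff (Finsupp.single i 1) a := by
  have h : ∀ c : MvPolynomial ι F,
      coeff (Finsupp.single i 1) c = constantCoeff (pderiv i c) := fun c => by
    rw [constantCoeff_eq, coeff_pderiv]; simp
  simp [h, Derivation.leibniz]

/-- The augmentation of a polynomial ring. -/
noncomputable abbrev polyAug (F ι : Type*) [Field F] : MvPolynomial ι F →ₐ[F] F :=
  aeval fun _ => 0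

theorem polyAug_apply (c : MvPolynomial ι F) : polyAug F ι c = constantCoeff c := by
  simp [polyAug]

theorem coeff_single_one_monomial_eq_zero {i : ι} {α : ι →₀ ℕ} (h : α ≠ Finsupp.single i 1) :
    coeff (Finsupp.single i 1) (monomial α (1 : F)) = 0 := by
  classical
  rw [coeff_monomial, if_neg h]

theorem pMap_iterate_eq_zero_of_le {N : ℕ} (hN : ∀ y : M, (pMap p F)^[N] y = 0) {j : ℕ}
    (hj : N ≤ j) (y : M) : (pMap p F)^[j] y = 0 := by
  obtain ⟨k, rfl⟩ := Nat.exists_eq_add_of_le hj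
  rw [Function.iterate_add_apply, hN]

variable [Fintype ι]

/-- A biderivation whose antisymmetrization is the bracket of the elements `x i`. -/
noncomputable def halfBracket [LinearOrder ι] (F : Type*) [Field F] [LieAlgebra F M] (x : ι → M) :
    AugBiderivation (polyAug F ι) (bracketSpan F M) where
  form := LinearMap.mk₂ F
    -- Keeping one ordering of each pair avoids dividing by two, so that `p = 2` is covered.
    (fun a b => ∑ i, ∑ j, if j < i then
      (coeff (Finsupp.single i 1) a * coeff (Finsupp.single j 1) b) •
        (⟨⁅x i, x j⁆, lie_mem_bracketSpan _ _⟩ : bracketSpan F M) else 0)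
    (fun a a' b => by
      simp only [← Finset.sum_add_distrib]
      refine Finset.sum_congr rfl fun i _ => Finset.sum_congr rfl fun j _ => ?_
      split_ifs
      · rw [coeff_add, add_mul, add_smul]
      · rw [add_zero])
    (fun t a b => by
      simp only [Finset.smul_sum]
      refine Finset.sum_congr rfl fun i _ => Finset.sum_congr rfl fun j _ => ?_
      split_ifs
      · rw [coeff_smul, smul_smul, smul_eq_mul, mul_assoc]
      · rw [smul_zero])
    (fun a b b' => by
      simp only [← Finset.sum_add_distrib]
      refine Finset.sum_congr rfl fun i _ => Finset.sum_congr rfl fun j _ => ?_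
      split_ifs
      · rw [coeff_add, mul_add, add_smul]
      · rw [add_zero])
    (fun t a b => by
      simp only [Finset.smul_sum]
      refine Finset.sum_congr rfl fun i _ => Finset.sum_congr rfl fun j _ => ?_
      split_ifs
      · rw [coeff_smul, smul_smul, smul_eq_mul, mul_left_comm]
      · rw [smul_zero])
  mul_left := fun a b c => by
    simp only [LinearMap.mk₂_apply, Finset.smul_sum, ← Finset.sum_add_distrib]
    refine Finset.sum_congr rfl fun i _ => Finset.sum_congr rfl fun j _ => ?_
    split_ifs
    · rw [coeff_single_one_mul, smul_smul, smul_smul, ← add_smul, polyAug_apply, polyAug_apply]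
      congr 1
      ring
    · simp
  mul_right := fun a b c => by
    simp only [LinearMap.mk₂_apply, Finset.smul_sum, ← Finset.sum_add_distrib]
    refine Finset.sum_congr rfl fun i _ => Finset.sum_congr rfl fun j _ => ?_
    split_ifs
    · rw [coeff_single_one_mul, smul_smul, smul_smul, ← add_smul, polyAug_apply, polyAug_apply]
      congr 1
      ring
    · simp

theorem coe_halfBracket [LinearOrder ι] (x : ι → M) (a b : MvPolynomial ι F) :
    (((halfBracket F x).form a b : bracketSpan F M) : M) = ∑ i, ∑ j, if j < i then
      (coeff (Finsupp.single i 1) a * coeff (Finsupp.single j 1) b) • ⁅x i, x j⁆ else 0 := by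
  simp only [halfBracket, LinearMap.mk₂_apply, Submodule.coe_sum]
  refine Finset.sum_congr rfl fun i _ => Finset.sum_congr rfl fun j _ => ?_
  split_ifs <;> simp

theorem halfBracket_sub_swap [LinearOrder ι] (x : ι → M) (a b : MvPolynomial ι F) :
    (((halfBracket F x).form a b - (halfBracket F x).form b a : bracketSpan F M) : M) =
      ∑ i, ∑ j, (coeff (Finsupp.single i 1) a * coeff (Finsupp.single j 1) b) • ⁅x i, x j⁆ := by
  rw [Submodule.coe_sub, coe_halfBracket, coe_halfBracket]
  conv_lhs => arg 2; rw [Finset.sum_comm]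
  simp only [← Finset.sum_sub_distrib]
  refine Finset.sum_congr rfl fun i _ => Finset.sum_congr rfl fun j _ => ?_
  rcases lt_trichotomy i j with h | rfl | h
  · rw [if_neg h.not_gt, if_pos h, ← lie_skew (x i), smul_neg, zero_sub, mul_comm]
  · simp
  · rw [if_pos h, if_neg h.not_gt, sub_zero]

theorem halfBracket_eq_zero_left [LinearOrder ι] (x : ι → M) {a : MvPolynomial ι F}
    (ha : ∀ i, coeff (Finsupp.single i 1) a = 0) (b : MvPolynomial ι F) :
    (halfBracket F x).form a b = 0 := by
  apply Subtype.ext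
  simp [coe_halfBracket, ha]

theorem halfBracket_eq_zero_right [LinearOrder ι] (x : ι → M) (a : MvPolynomial ι F)
    {b : MvPolynomial ι F} (hb : ∀ i, coeff (Finsupp.single i 1) b = 0) :
    (halfBracket F x).form a b = 0 := by
  apply Subtype.ext
  simp [coe_halfBracket, hb]

/-- A nonzero term would need the same monomial to be both `X i` and `X j` with `j < i`. So the
`p`-th power of a monomial has no second component even when `p = 2`. -/
theorem halfBracket_monomial_self [LinearOrder ι] (x : ι → M) (α : ι →₀ ℕ) :
    (halfBracket F x).form (monomial α (1 : F)) (monomial α 1) = 0 := by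
  apply Subtype.ext
  rw [coe_halfBracket]
  refine Finset.sum_eq_zero fun i _ => Finset.sum_eq_zero fun j _ => ?_
  split_ifs with h
  · by_cases hi : α = Finsupp.single i 1
    · rw [coeff_single_one_monomial_eq_zero (i := j), mul_zero, zero_smul]
      rintro rfl
      exact h.ne ((Finsupp.single_left_injective one_ne_zero) hi)
    · rw [coeff_single_one_monomial_eq_zero hi, zero_mul, zero_smul]
  · rfl

variable (p F) in
/-- The linear projection of a polynomial ring to `M` which sends `X i ^ p ^ j` to the `j`-th
`p`-power of `x i` and kills the other monomials. -/
noncomputable def polyProj (N : ℕ) (x : ι → M) : MvPolynomial ι F →ₗ[F] M :=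
  ∑ i, ∑ j ∈ Finset.range (N + 1),
    (lcoeff F (Finsupp.single i (p ^ j))).smulRight ((pMap p F)^[j] (x i))

theorem polyProj_apply (N : ℕ) (x : ι → M) (c : MvPolynomial ι F) :
    polyProj p F N x c = ∑ i, ∑ j ∈ Finset.range (N + 1),
      coeff (Finsupp.single i (p ^ j)) c • (pMap p F)^[j] (x i) := by
  simp [polyProj, LinearMap.sum_apply, lcoeff_apply]

theorem polyProj_monomial_eq_zero (N : ℕ) (x : ι → M) {α : ι →₀ ℕ}
    (h : ∀ i j, α ≠ Finsupp.single i (p ^ j)) : polyProj p F N x (monomial α 1) = 0 := by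
  classical
  rw [polyProj_apply]
  refine Finset.sum_eq_zero fun i _ => Finset.sum_eq_zero fun j _ => ?_
  rw [coeff_monomial, if_neg (h i j), zero_smul]

section

variable [LinearOrder ι]

variable (p F) in
/-- The projection of the extended polynomial ring to `M`. -/
noncomputable def extProj (N : ℕ) (x : ι → M) : BiderivationExt (halfBracket F x) →ₗ[F] M where
  toFun u := polyProj p F N x u.1 + (u.2 : M)
  map_add' u v := by
    simp only [BiderivationExt.add_fst, BiderivationExt.add_snd, map_add, Submodule.coe_add]
    abel
  map_smul' a u := by simp

theorem extProj_apply (N : ℕ) (x : ι → M) (u : BiderivationExt (halfBracket F x)) :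
    extProj p F N x u = polyProj p F N x u.1 + (u.2 : M) := rfl

/-- A product of polynomials without constant term has no linear term, and every surviving higher
monomial is sent to a value of the `p`-map. -/
theorem extProj_mul_mem (N : ℕ) (x : ι → M) (u v : BiderivationExt (halfBracket F x))
    (hu : polyAug F ι u.1 = 0) (hv : polyAug F ι v.1 = 0) :
    extProj p F N x (u * v) ∈ bracketSpan F M ⊔ Submodule.span F (Set.range (pMap p F)) := by
  rw [extProj_apply]
  refine add_mem (Submodule.mem_sup_right ?_) (Submodule.mem_sup_left (u * v).2.2)
  rw [polyProj_apply]
  refine sum_mem fun i _ => sum_mem fun j _ => ?_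
  rcases j with _ | j
  · rw [BiderivationExt.mul_fst, pow_zero, coeff_single_one_mul, ← polyAug_apply,
      ← polyAug_apply, hu, hv]
    simp
  · rw [Function.iterate_succ_apply']
    exact Submodule.smul_mem _ _ (Submodule.subset_span ⟨_, rfl⟩)

end

variable [hp : Fact p.Prime]

theorem polyProj_monomial_single {N : ℕ} (hN : ∀ y : M, (pMap p F)^[N] y = 0) (x : ι → M)
    (i : ι) (j : ℕ) : polyProj p F N x (monomial (Finsupp.single i (p ^ j)) 1) =
      (pMap p F)^[j] (x i) := by
  classical
  have hpj : ∀ k, p ^ k ≠ 0 := fun k => pow_ne_zero _ hp.out.ne_zero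
  rw [polyProj_apply, Finset.sum_eq_single i]
  · by_cases hj : j < N + 1
    · rw [Finset.sum_eq_single j]
      · simp
      · intro k _ hk
        rw [coeff_monomial, if_neg, zero_smul]
        intro h
        exact hk (Nat.pow_right_injective hp.out.two_le (Finsupp.single_injective i h)).symm
      · intro h; exact absurd (Finset.mem_range.2 hj) h
    · rw [pMap_iterate_eq_zero_of_le hN (by omega)]
      refine Finset.sum_eq_zero fun k hk => ?_
      rw [coeff_monomial, if_neg, zero_smul]
      intro h
      have := Nat.pow_right_injective hp.out.two_le (Finsupp.single_injective i h)
      have := Finset.mem_range.1 hk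
      omega
  · intro k _ hk
    refine Finset.sum_eq_zero fun l _ => ?_
    rw [coeff_monomial, if_neg, zero_smul]
    intro h
    rcases (Finsupp.single_eq_single_iff _ _ _ _).1 h with h | h
    · exact hk h.1.symm
    · exact hpj _ h.1
  · intro h; exact absurd (Finset.mem_univ _) h

/-- Values of the `p`-map are central, so only the terms with `j = 0` contribute. -/
theorem polyProj_lie (hM : IsClassTwo p F M) (N : ℕ) (x : ι → M) (c : MvPolynomial ι F) (y : M) :
    ⁅polyProj p F N x c, y⁆ = ∑ i, coeff (Finsupp.single i 1) c • ⁅x i, y⁆ := by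
  rw [polyProj_apply, sum_lie]
  refine Finset.sum_congr rfl fun i _ => ?_
  rw [sum_lie, Finset.sum_range_succ', Finset.sum_eq_zero]
  · simp
  · intro j _
    rw [Function.iterate_succ_apply', smul_lie, hM.pMap_lie, smul_zero]

variable [LinearOrder ι]

/-- Both the antisymmetrized form and the bracket of the projections depend only on linear
coefficients, where they agree. -/
theorem commutator_eq_lie (hM : IsClassTwo p F M) (N : ℕ) (x : ι → M)
    (u v : BiderivationExt (halfBracket F x)) :
    u * v - v * u = BiderivationExt.mk _ 0
      ⟨⁅extProj p F N x u, extProj p F N x v⁆, lie_mem_bracketSpan _ _⟩ := by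
  rw [BiderivationExt.commutator_eq]
  congr 1
  apply Subtype.ext
  rw [halfBracket_sub_swap]
  change _ = ⁅extProj p F N x u, extProj p F N x v⁆
  rw [extProj_apply, extProj_apply, add_lie, lie_add,
    hM.lie_mem_left u.2.2, hM.lie_mem_right v.2.2, add_zero, add_zero, polyProj_lie hM]
  refine Finset.sum_congr rfl fun i _ => ?_
  rw [← lie_skew, polyProj_lie hM, ← Finset.sum_neg_distrib, Finset.smul_sum]
  refine Finset.sum_congr rfl fun j _ => ?_
  rw [← smul_neg, lie_skew, smul_smul]

theorem extProj_lie (hM : IsClassTwo p F M) (N : ℕ) (x : ι → M)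
    (u v : BiderivationExt (halfBracket F x)) :
    extProj p F N x (u * v - v * u) = ⁅extProj p F N x u, extProj p F N x v⁆ := by
  rw [commutator_eq_lie hM N, extProj_apply (N := N)]
  simp

variable [CharP F p]

/-- Both sides have the same additivity defect, since `extProj` respects commutators. The solutions
therefore form a subspace, and it suffices to test central elements and nonconstant monomials. -/
theorem extProj_pow (hM : IsClassTwo p F M) {N : ℕ} (hN : ∀ y : M, (pMap p F)^[N] y = 0)
    (x : ι → M) (u : BiderivationExt (halfBracket F x)) (hu : polyAug F ι u.1 = 0) :
    extProj p F N x (u ^ p) = pMap p F (extProj p F N x u) := by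
  let G : Submodule F (BiderivationExt (halfBracket F x)) :=
    { carrier := {u | polyAug F ι u.1 = 0 ∧
        extProj p F N x (u ^ p) = pMap p F (extProj p F N x u)}
      zero_mem' := ⟨by simp, by rw [zero_pow hp.out.ne_zero, map_zero, pMap_zero]⟩
      add_mem' := by
        rintro u v ⟨hu, hu'⟩ ⟨hv, hv'⟩
        refine ⟨by rw [BiderivationExt.add_fst, map_add, hu, hv, add_zero], ?_⟩
        rw [BiderivationExt.add_pow_prime hu hv, map_add, map_add, hu', hv', map_add,
          hM.pMap_add_eq]
        congr 1
        split_ifs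
        · rw [extProj_lie hM]
        · rw [map_zero]
      smul_mem' := by
        rintro a u ⟨hu, hu'⟩
        refine ⟨by rw [BiderivationExt.smul_fst, map_smul, hu, smul_zero], ?_⟩
        rw [smul_pow, map_smul, hu', map_smul, pMap_smul] }
  have hz : ∀ z : bracketSpan F M, BiderivationExt.mk (halfBracket F x) 0 z ∈ G := by
    intro z
    refine ⟨by simp, ?_⟩
    rw [BiderivationExt.pow_prime hp.out (by simp), extProj_apply, extProj_apply]
    simp only [BiderivationExt.mk_fst, BiderivationExt.mk_snd, map_zero, zero_add]
    rw [hM.pMap_eq_zero _ z.2]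
    simp [hp.out.ne_zero]
  have hmono : ∀ α : ι →₀ ℕ, α ≠ 0 →
      BiderivationExt.mk (halfBracket F x) (monomial α 1) 0 ∈ G := by
    intro α hα
    have h0 : polyAug F ι (monomial α (1 : F)) = 0 := by
      classical
      rw [polyAug_apply, constantCoeff_eq, coeff_monomial, if_neg hα]
    refine ⟨h0, ?_⟩
    rw [BiderivationExt.pow_prime hp.out h0, extProj_apply, extProj_apply]
    simp only [BiderivationExt.mk_fst, BiderivationExt.mk_snd, halfBracket_monomial_self,
      ite_self, Submodule.coe_zero, add_zero, monomial_pow, one_pow]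
    by_cases h : ∃ i j, α = Finsupp.single i (p ^ j)
    · obtain ⟨i, j, rfl⟩ := h
      rw [Finsupp.smul_single, smul_eq_mul, ← pow_succ', polyProj_monomial_single hN,
        polyProj_monomial_single hN, Function.iterate_succ_apply']
    · push Not at h
      rw [polyProj_monomial_eq_zero N x h, pMap_zero, polyProj_monomial_eq_zero]
      -- An equality `p • α = single i (p ^ j)` would give `p ∣ 1` if `j = 0`, and otherwise `α =
      -- single i (p ^ (j - 1))`, which `h` excludes.
      intro i j hij
      have hval : ∀ k, p * α k = Finsupp.single i (p ^ j) k := fun k => by rw [← hij]; simp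
      rcases j with _ | j
      · have := hval i
        rw [Finsupp.single_eq_same, pow_zero] at this
        exact hp.out.one_lt.ne' (Nat.eq_one_of_mul_eq_one_right this)
      · refine h i j (Finsupp.ext fun k => ?_)
        have := hval k
        rw [pow_succ', ← smul_eq_mul p (p ^ j), ← Finsupp.smul_single, Finsupp.smul_apply,
          smul_eq_mul] at this
        exact Nat.eq_of_mul_eq_mul_left hp.out.pos this
  suffices h : u ∈ G from h.2
  have hsum : u = BiderivationExt.mk _ 0 u.2 + ∑ α ∈ u.1.support,
      coeff α u.1 • BiderivationExt.mk (halfBracket F x) (monomial α 1) 0 := by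
    let inl : MvPolynomial ι F →ₗ[F] BiderivationExt (halfBracket F x) :=
      { toFun := fun c => BiderivationExt.mk _ c 0
        map_add' := fun c d => by ext1 <;> simp
        map_smul' := fun a c => by ext1 <;> simp }
    have h1 : ∑ α ∈ u.1.support, coeff α u.1 •
        BiderivationExt.mk (halfBracket F x) (monomial α 1) 0 = inl u.1 := by
      conv_rhs => rw [u.1.as_sum, map_sum]
      refine Finset.sum_congr rfl fun α _ => ?_
      rw [← mul_one (coeff α u.1), ← smul_eq_mul, ← smul_monomial, map_smul, smul_eq_mul, mul_one]
      rfl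
    rw [h1]
    ext1 <;> simp [inl]
  rw [hsum]
  refine add_mem (hz _) (sum_mem fun α hα => G.smul_mem _ (hmono α ?_))
  rintro rfl
  rw [mem_support_iff, ← constantCoeff_eq, ← polyAug_apply] at hα
  exact hα hu

end Model

/-! ### The retraction of `u(M)` onto `M` -/

section Projection

open MvPolynomial

/-- The largest two-sided ideal contained in the kernels of a linear map and of an algebra map. -/
def largestIdealLE {F E M : Type*} [Field F] [Ring E] [Algebra F E] [AddCommGroup M] [Module F M]
    (ε : E →ₐ[F] F) (τ : E →ₗ[F] M) : TwoSidedIdeal E :=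
  TwoSidedIdeal.mk' {k | ε k = 0 ∧ ∀ a b, τ (a * k * b) = 0}
    ⟨map_zero _, fun a b => by simp⟩
    (fun {k l} hk hl => ⟨by rw [map_add, hk.1, hl.1, add_zero], fun a b => by
      rw [mul_add, add_mul, map_add, hk.2, hl.2, add_zero]⟩)
    (fun {k} hk => ⟨by rw [map_neg, hk.1, neg_zero], fun a b => by
      rw [mul_neg, neg_mul, map_neg, hk.2, neg_zero]⟩)
    (fun {c k} hk => ⟨by rw [map_mul, hk.1, mul_zero], fun a b => by
      rw [← mul_assoc, hk.2]⟩)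
    (fun {k c} hk => ⟨by rw [map_mul, hk.1, zero_mul], fun a b => by
      rw [← mul_assoc, mul_assoc, hk.2]⟩)

theorem mem_largestIdealLE {F E M : Type*} [Field F] [Ring E] [Algebra F E] [AddCommGroup M]
    [Module F M] {ε : E →ₐ[F] F} {τ : E →ₗ[F] M} {k : E} :
    k ∈ largestIdealLE ε τ ↔ ε k = 0 ∧ ∀ a b, τ (a * k * b) = 0 :=
  TwoSidedIdeal.mem_mk' ..

variable {p : ℕ} {F M : Type*} [Field F] [LieRing M] [LieAlgebra F M] [RestrictedLieAlgebra p F M]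
  [hp : Fact p.Prime]

/-- Multiplying `X i ^ p ^ n` by a nonconstant monomial gives either a monomial that is killed or `X
i ^ p ^ j` with `j > n`, whose image vanishes by `hn`. -/
theorem polyProj_mul_pow {ι : Type*} [Fintype ι] {N : ℕ} (hN : ∀ y : M, (pMap p F)^[N] y = 0)
    (x : ι → M) {i : ι} {n : ℕ} (hn : pMap p F ((pMap p F)^[n] (x i)) = 0)
    (c : MvPolynomial ι F) : polyProj p F N x (c * monomial (Finsupp.single i (p ^ n)) 1) =
      constantCoeff c • (pMap p F)^[n] (x i) := by
  induction c using MvPolynomial.induction_on' with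
  | add c d hc hd => rw [add_mul, map_add, hc, hd, map_add, add_smul]
  | monomial α r =>
    rw [← mul_one r, ← smul_eq_mul (a := r), ← smul_monomial, smul_mul_assoc, map_smul,
      monomial_mul, one_mul]
    by_cases hα : α = 0
    · subst hα
      rw [zero_add, polyProj_monomial_single hN]
      simp
    · have h0 : constantCoeff (r • monomial α (1 : F)) = 0 := by
        classical
        rw [constantCoeff_eq, coeff_smul, coeff_monomial, if_neg hα, smul_zero]
      rw [h0, zero_smul]
      by_cases h : ∃ i' j, α + Finsupp.single i (p ^ n) = Finsupp.single i' (p ^ j)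
      · obtain ⟨i', j, h⟩ := h
        have hi : i' = i := by
          by_contra hne
          have := congrArg (fun f => f i) h
          simp only [Finsupp.add_apply, Finsupp.single_eq_same] at this
          rw [Finsupp.single_eq_of_ne (Ne.symm hne)] at this
          have := pow_pos hp.out.pos n
          omega
        subst hi
        have hlt : n < j := by
          by_contra hle
          have hle := Nat.pow_le_pow_right hp.out.pos (not_lt.1 hle)
          have hd := congrArg Finsupp.degree h
          simp only [map_add, Finsupp.degree_single] at hd
          have : α.degree = 0 := by omega
          exact hα ((Finsupp.degree_eq_zero_iff α).1 this)
        obtain ⟨k, rfl⟩ := Nat.exists_eq_add_of_lt hlt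
        rw [h, polyProj_monomial_single hN, show n + k + 1 = k + (n + 1) by omega,
          Function.iterate_add_apply, Function.iterate_succ_apply', hn,
          Function.iterate_fixed pMap_zero, smul_zero]
      · push Not at h
        rw [polyProj_monomial_eq_zero N x h, smul_zero]

/-- For a finite-dimensional `p`-nilpotent restricted Lie algebra `M` of class two over a perfect
field, there is a linear retraction of `M → u(M)` compatible on the augmentation ideal with
commutators and `p`-th powers. -/
theorem IsClassTwo.exists_retraction [CharP F p] [PerfectField F] [FiniteDimensional F M]
    (hM : IsClassTwo p F M) (hnil : IsPNilpotent p F M) :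
    ∃ π : RestrictedEnvelopingAlgebra p F M →ₗ[F] M,
      (∀ y, π (envι p F y) = y) ∧ (∀ u v, π (u * v - v * u) = ⁅π u, π v⁆) ∧
      (∀ u, augmentation p F M u = 0 → π (u ^ p) = pMap p F (π u)) ∧
      ∀ u v, augmentation p F M u = 0 → augmentation p F M v = 0 →
        π (u * v) ∈ bracketSpan F M ⊔ Submodule.span F (Set.range (pMap p F)) := by
  obtain ⟨N, hN⟩ := hnil
  obtain ⟨ι, _, n, xb, b, hn, hb, hnx⟩ := exists_jordan_chains _ hM.abelianPMap N
    (fun v => by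
      obtain ⟨m, rfl⟩ := (bracketSpan F M).mkQ_surjective v
      rw [hM.abelianPMap_iterate, hN, map_zero]) rfl
  choose x hx using fun i => (bracketSpan F M).mkQ_surjective (xb i)
  have hbx : ∀ s, b s = (bracketSpan F M).mkQ ((pMap p F)^[s.2] (x s.1)) := fun s => by
    rw [hb, ← hx, hM.abelianPMap_iterate]
  have hnx' : ∀ i, (pMap p F)^[n i] (x i) ∈ bracketSpan F M := fun i => by
    have := hnx i
    rw [← hx, hM.abelianPMap_iterate] at this
    exact (Submodule.Quotient.mk_eq_zero _).1 this
  let _ : LinearOrder ι := LinearOrder.lift' (Fintype.equivFin ι) (Fintype.equivFin ι).injective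
  let τ := extProj p F N x
  -- Chain vectors go to the matching powers `X i ^ p ^ j`, and brackets go to zero.
  let s₀ : M →ₗ[F] MvPolynomial ι F :=
    (b.constr F fun s => monomial (Finsupp.single s.1 (p ^ (s.2 : ℕ))) (1 : F)) ∘ₗ
      (bracketSpan F M).mkQ
  have hs₀x : ∀ i (j : Fin (n i)), s₀ ((pMap p F)^[j] (x i)) =
      monomial (Finsupp.single i (p ^ (j : ℕ))) 1 := fun i j => by
    rw [LinearMap.comp_apply, ← hbx ⟨i, j⟩, Module.Basis.constr_basis]
  have hs₀z : ∀ z ∈ bracketSpan F M, s₀ z = 0 := fun z hz => by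
    rw [LinearMap.comp_apply, Submodule.mkQ_apply, (Submodule.Quotient.mk_eq_zero _).2 hz,
      map_zero]
  have hspan : ∀ m : M, m ∈ bracketSpan F M ⊔
      Submodule.span F (Set.range fun s : (Σ i, Fin (n i)) => (pMap p F)^[s.2] (x s.1)) := by
    intro m
    have h1 : m - ∑ s, b.repr ((bracketSpan F M).mkQ m) s • (pMap p F)^[s.2] (x s.1) ∈
        bracketSpan F M := by
      rw [← Submodule.Quotient.mk_eq_zero, ← Submodule.mkQ_apply, map_sub, map_sum]
      simp only [map_smul, ← hbx, b.sum_repr, sub_self]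
    rw [← sub_add_cancel m (∑ s, b.repr ((bracketSpan F M).mkQ m) s • (pMap p F)^[s.2] (x s.1))]
    exact add_mem (Submodule.mem_sup_left h1) (Submodule.mem_sup_right
      (sum_mem fun s _ => Submodule.smul_mem _ _ (Submodule.subset_span ⟨s, rfl⟩)))
  have hmem : ∀ m, m - polyProj p F N x (s₀ m) ∈ bracketSpan F M := by
    intro m
    obtain ⟨z, hz, y, hy, rfl⟩ := Submodule.mem_sup.1 (hspan m)
    rw [map_add, hs₀z z hz, zero_add, add_sub_assoc]
    refine add_mem hz ?_
    suffices y - polyProj p F N x (s₀ y) = 0 by rw [this]; exact zero_mem _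
    induction hy using Submodule.span_induction with
    | mem y hy =>
      obtain ⟨⟨i, j⟩, rfl⟩ := hy
      rw [hs₀x, polyProj_monomial_single hN, sub_self]
    | zero => simp
    | add y y' _ _ h h' => rw [map_add, map_add, add_sub_add_comm, h, h', add_zero]
    | smul a y _ h => rw [map_smul, map_smul, ← smul_sub, h, smul_zero]
  -- The second component is the correction that makes `τ ∘ s` the identity.
  let s : M →ₗ[F] BiderivationExt (halfBracket F x) :=
    { toFun := fun m => BiderivationExt.mk _ (s₀ m) ⟨m - polyProj p F N x (s₀ m), hmem m⟩
      map_add' := fun m m' => by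
        ext1
        · simp
        · apply Subtype.ext
          simp only [BiderivationExt.mk_snd, BiderivationExt.add_snd, Submodule.coe_add, map_add]
          abel
      map_smul' := fun a m => by
        ext1
        · simp
        · apply Subtype.ext
          simp [smul_sub] }
  have hs1 : ∀ m, (s m).1 = s₀ m := fun m => rfl
  have hs2 : ∀ m, ((s m).2 : M) = m - polyProj p F N x (s₀ m) := fun m => rfl
  have hτs : ∀ m, τ (s m) = m := fun m => by
    rw [extProj_apply, hs1, hs2, add_sub_cancel]
  have hsz : ∀ z (hz : z ∈ bracketSpan F M), s z = BiderivationExt.mk _ 0 ⟨z, hz⟩ := by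
    intro z hz
    ext1
    · exact hs₀z z hz
    · apply Subtype.ext
      rw [hs2, hs₀z z hz, map_zero, sub_zero]
      rfl
  have hsx : ∀ i (j : Fin (n i)), s ((pMap p F)^[j] (x i)) =
      BiderivationExt.mk _ (monomial (Finsupp.single i (p ^ (j : ℕ))) 1) 0 := by
    intro i j
    ext1
    · exact hs₀x i j
    · apply Subtype.ext
      rw [hs2, hs₀x, polyProj_monomial_single hN, sub_self]
      rfl
  have hmon : ∀ (i : ι) (k : ℕ), polyAug F ι (monomial (Finsupp.single i (p ^ k)) 1) = 0 := by
    classical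
    intro i k
    rw [polyAug_apply, constantCoeff_eq, coeff_monomial, if_neg]
    rw [Finsupp.single_eq_zero]
    exact pow_ne_zero _ hp.out.ne_zero
  have haug : ∀ m, polyAug F ι (s m).1 = 0 := by
    have hle : bracketSpan F M ⊔ Submodule.span F
        (Set.range fun s : (Σ i, Fin (n i)) => (pMap p F)^[s.2] (x s.1)) ≤
        LinearMap.ker ((polyAug F ι).toLinearMap ∘ₗ s₀) := by
      refine sup_le (fun z hz => ?_) (Submodule.span_le.2 ?_)
      · rw [LinearMap.mem_ker, LinearMap.comp_apply, hs₀z z hz, map_zero]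
      · rintro _ ⟨⟨i, j⟩, rfl⟩
        exact (congrArg (polyAug F ι) (hs₀x i j)).trans (hmon i j)
    exact fun m => hle (hspan m)
  -- At a chain end `X i ^ p ^ n i` is not `s` of the corresponding `p`-power, which lies in `M'`.
  -- Their difference has to be factored out, inside an ideal on which `τ` vanishes.
  let K := largestIdealLE (BiderivationExt.aug (halfBracket F x)) τ
  have hK : ∀ i, BiderivationExt.mk (halfBracket F x)
      (monomial (Finsupp.single i (p ^ n i)) 1) (-⟨_, hnx' i⟩) ∈ K := by
    intro i
    rw [mem_largestIdealLE]
    refine ⟨hmon i (n i), fun u v => ?_⟩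
    -- Since `n i > 0`, this power has no linear part and the form ignores it. Under `τ` its
    -- multiples then contribute only through constant terms and cancel against the central
    -- component.
    have hlin : ∀ j, coeff (Finsupp.single j 1)
        (monomial (Finsupp.single i (p ^ n i)) (1 : F)) = 0 := by
      intro j
      refine coeff_single_one_monomial_eq_zero fun h => ?_
      rcases (Finsupp.single_eq_single_iff _ _ _ _).1 h with h | h
      · exact (Nat.one_lt_pow (hn i).ne' hp.out.one_lt).ne' h.2
      · exact one_ne_zero h.2
    change extProj p F N x _ = 0
    rw [extProj_apply]
    simp only [BiderivationExt.mul_fst, BiderivationExt.mul_snd, BiderivationExt.mk_fst,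
      BiderivationExt.mk_snd, map_mul, hmon, mul_zero, zero_smul, add_zero, zero_add,
      halfBracket_eq_zero_right x _ hlin, (halfBracket F x).mul_left,
      halfBracket_eq_zero_left x hlin, smul_zero]
    rw [mul_right_comm, polyProj_mul_pow hN x (hM.pMap_eq_zero _ (hnx' i)), smul_neg, smul_neg,
      smul_smul, polyAug_apply, polyAug_apply, map_mul, mul_comm (constantCoeff v.1)]
    simp
  have hlie : ∀ m m', s ⁅m, m'⁆ = s m * s m' - s m' * s m := by
    intro m m'
    rw [commutator_eq_lie hM N, hsz _ (lie_mem_bracketSpan m m')]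
    congr 2
    exact (congrArg₂ (⁅·, ·⁆) (hτs m) (hτs m')).symm
  have hsmul : ∀ (a : F) k, k ∈ K → a • k ∈ K := fun a k hk => by
    rw [Algebra.smul_def]
    exact K.mul_mem_left _ _ hk
  -- Equal additivity defects again reduce this to `M'` and chain vectors; only the last vector of a
  -- chain needs `hK`.
  have hsK : ∀ m, s m ^ p - s (pMap p F m) ∈ K := by
    let G : Submodule F M :=
      { carrier := {m | s m ^ p - s (pMap p F m) ∈ K}
        zero_mem' := by
          simp [pMap_zero, hp.out.ne_zero, K.zero_mem]
        add_mem' := by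
          intro m m' h h'
          change s (m + m') ^ p - s (pMap p F (m + m')) ∈ K
          rw [map_add, BiderivationExt.add_pow_prime (haug m) (haug m'), hM.pMap_add_eq,
            map_add, map_add, apply_ite s, hlie, map_zero, add_sub_add_right_eq_sub,
            add_sub_add_comm]
          exact K.add_mem h h'
        smul_mem' := by
          intro a m h
          change s (a • m) ^ p - s (pMap p F (a • m)) ∈ K
          rw [map_smul, pMap_smul, map_smul, smul_pow, ← smul_sub]
          exact hsmul _ _ h }
    have hle : bracketSpan F M ⊔ Submodule.span F
        (Set.range fun s : (Σ i, Fin (n i)) => (pMap p F)^[s.2] (x s.1)) ≤ G := by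
      refine sup_le (fun z hz => ?_) (Submodule.span_le.2 ?_)
      · change s z ^ p - s (pMap p F z) ∈ K
        rw [hM.pMap_eq_zero z hz, map_zero, sub_zero, BiderivationExt.pow_prime hp.out (haug z),
          hs1, hs₀z z hz]
        simp only [map_zero, ite_self, zero_pow hp.out.ne_zero]
        exact K.zero_mem
      · rintro _ ⟨⟨i, j⟩, rfl⟩
        change s ((pMap p F)^[j] (x i)) ^ p - s (pMap p F ((pMap p F)^[j] (x i))) ∈ K
        rw [BiderivationExt.pow_prime hp.out (haug _), hsx,
          ← Function.iterate_succ_apply' (pMap p F)]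
        simp only [BiderivationExt.mk_fst, halfBracket_monomial_self, ite_self, monomial_pow,
          one_pow, Finsupp.smul_single, smul_eq_mul, ← pow_succ']
        by_cases hj : (j : ℕ) + 1 < n i
        · rw [hsx i ⟨j + 1, hj⟩, sub_self]
          exact K.zero_mem
        · have hj' : (j : ℕ) + 1 = n i := by have := j.2; omega
          rw [Nat.succ_eq_add_one, hj', hsz _ (hnx' i)]
          convert hK i using 1
          ext1
          · simp
          · simp
    exact fun m => hle (hspan m)
  let mk := K.ringCon.mkₐ F
  have hmk : ∀ u v, mk u = mk v ↔ u - v ∈ K := fun u v => by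
    rw [← TwoSidedIdeal.rel_iff]
    exact K.ringCon.eq
  have hsurj : Function.Surjective mk := RingCon.mkₐ_surjective _
  let f : M →ₗ⁅F⁆ K.ringCon.Quotient :=
    { mk.toLinearMap ∘ₗ s with
      map_lie' := fun {m m'} => by
        change mk (s ⁅m, m'⁆) = mk (s m) * mk (s m') - mk (s m') * mk (s m)
        rw [hlie, map_sub, map_mul, map_mul] }
  have hf : ∀ m, f m = mk (s m) := fun m => rfl
  let G := envLift (p := p) f fun m => by
    rw [hf, hf, ← map_pow]
    exact (hmk _ _).2 (hsK m)
  -- Lifts are taken with matching augmentation, because the statements on powers and products hold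
  -- only on augmentation ideals.
  have hG : ∀ w, ∃ e, mk e = G w ∧ polyAug F ι e.1 = augmentation p F M w := by
    intro w
    induction w using env_induction with
    | hι m => exact ⟨s m, by rw [envLift_ι, hf], by rw [haug, augmentation_ι]⟩
    | hF a => exact ⟨algebraMap F _ a, by rw [AlgHom.commutes, AlgHom.commutes], by
        rw [AlgHom.commutes]; exact AlgHom.commutes (BiderivationExt.aug (halfBracket F x)) a⟩
    | hadd u v hu hv =>
      obtain ⟨e, h1, h2⟩ := hu
      obtain ⟨e', h1', h2'⟩ := hv
      exact ⟨e + e', by rw [map_add, map_add, h1, h1'], by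
        rw [BiderivationExt.add_fst, map_add, map_add, h2, h2']⟩
    | hmul u v hu hv =>
      obtain ⟨e, h1, h2⟩ := hu
      obtain ⟨e', h1', h2'⟩ := hv
      exact ⟨e * e', by rw [map_mul, map_mul, h1, h1'], by
        rw [BiderivationExt.mul_fst, map_mul, map_mul, h2, h2']⟩
  -- A linear section serves to define `π`; as `τ` vanishes on `K`, any other lift gives the same
  -- value (`hπ`).
  obtain ⟨r, hr⟩ :=
    mk.toLinearMap.exists_rightInverse_of_surjective (LinearMap.range_eq_top.2 hsurj)
  let π : RestrictedEnvelopingAlgebra p F M →ₗ[F] M := τ ∘ₗ r ∘ₗ G.toLinearMap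
  have hπ : ∀ w e, mk e = G w → π w = τ e := by
    intro w e he
    have h1 : mk (r (G w)) = mk e := (LinearMap.congr_fun hr (G w)).trans he.symm
    have h2 := (mem_largestIdealLE.1 ((hmk _ _).1 h1)).2 1 1
    rw [one_mul, mul_one, map_sub, sub_eq_zero] at h2
    exact h2
  refine ⟨π, fun y => ?_, fun u v => ?_, fun u hu => ?_, fun u v hu hv => ?_⟩
  · rw [hπ _ (s y) (by rw [envLift_ι, hf]), hτs]
  · obtain ⟨e, h1, -⟩ := hG u
    obtain ⟨e', h1', -⟩ := hG v
    rw [hπ u e h1, hπ v e' h1', hπ _ (e * e' - e' * e)]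
    · exact extProj_lie hM N x e e'
    · simp only [map_sub, map_mul, h1, h1']
  · obtain ⟨e, h1, h2⟩ := hG u
    rw [hπ u e h1, hπ _ (e ^ p) (by rw [map_pow, map_pow, h1])]
    exact extProj_pow hM hN x e (h2.trans hu)
  · obtain ⟨e, h1, h2⟩ := hG u
    obtain ⟨e', h1', h2'⟩ := hG v
    rw [hπ _ (e * e') (by rw [map_mul, map_mul, h1, h1'])]
    exact extProj_mul_mem N x e e' (h2.trans hu) (h2'.trans hv)

end Projection

/-! ### Generation modulo brackets and `p`-powers -/

section Surjectivity

variable {p : ℕ} {F M : Type*} [Field F] [LieRing M] [LieAlgebra F M] [RestrictedLieAlgebra p F M]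
  [hp : Fact p.Prime]

/-- A restricted subalgebra generating a `p`-nilpotent class two algebra modulo brackets and
`p`-powers is the whole algebra. -/
theorem IsClassTwo.eq_top_of_generates (hM : IsClassTwo p F M) (hnil : IsPNilpotent p F M)
    (S : Submodule F M) (hlie : ∀ x ∈ S, ∀ y ∈ S, ⁅x, y⁆ ∈ S) (hpow : ∀ x ∈ S, pMap p F x ∈ S)
    (hS : S ⊔ (bracketSpan F M ⊔ Submodule.span F (Set.range (pMap p F))) = ⊤) : S = ⊤ := by
  have hdec : ∀ x : M, ∃ s ∈ S, ∃ z ∈ bracketSpan F M,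
      ∃ w ∈ Submodule.span F (Set.range (pMap p F : M → M)), s + (z + w) = x := by
    intro x
    have hx : x ∈ S ⊔ (bracketSpan F M ⊔ Submodule.span F (Set.range (pMap p F))) := by
      rw [hS]; trivial
    obtain ⟨s, hs, y, hy, rfl⟩ := Submodule.mem_sup.1 hx
    obtain ⟨z, hz, w, hw, rfl⟩ := Submodule.mem_sup.1 hy
    exact ⟨s, hs, z, hz, w, hw, rfl⟩
  have hcen : ∀ w ∈ Submodule.span F (Set.range (pMap p F : M → M)), ∀ y : M, ⁅w, y⁆ = 0 := by
    intro w hw y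
    induction hw using Submodule.span_induction with
    | mem w hw => obtain ⟨v, rfl⟩ := hw; exact hM.pMap_lie v y
    | zero => simp
    | add a b _ _ ha hb => rw [add_lie, ha, hb, add_zero]
    | smul t a _ ha => rw [smul_lie, ha, smul_zero]
  -- Brackets and `p`-powers are central, so every bracket in `M` is already a bracket of elements
  -- of `S`.
  have hred : ∀ x : M, ∃ s ∈ S, ∀ y : M, ⁅x, y⁆ = ⁅s, y⁆ := by
    intro x
    obtain ⟨s, hs, z, hz, w, hw, rfl⟩ := hdec x
    exact ⟨s, hs, fun y => by
      rw [add_lie, add_lie, hM.lie_mem_left hz, hcen w hw, add_zero, add_zero]⟩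
  have hZ : bracketSpan F M ≤ S := by
    refine Submodule.span_le.2 ?_
    rintro _ ⟨x, y, rfl⟩
    obtain ⟨s, hs, h⟩ := hred x
    obtain ⟨t, ht, h'⟩ := hred y
    rw [h, ← lie_skew, h', lie_skew]
    exact hlie s hs t ht
  obtain ⟨N, hN⟩ := hnil
  -- The complement to `S` is pushed into ever higher `p`-powers, which vanish at `k = N`.
  have key : ∀ (k : ℕ) (x : M), x ∈ S ⊔ Submodule.span F (Set.range (pMap p F : M → M)^[k]) := by
    intro k
    induction k with
    | zero => exact fun x => Submodule.mem_sup_right (Submodule.subset_span ⟨x, rfl⟩)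
    | succ k ih =>
      set W := S ⊔ Submodule.span F (Set.range (pMap p F : M → M)^[k + 1])
      -- This is a subspace because the additivity defect of the `p`-map lies in `M' ≤ S`.
      let T : Submodule F M :=
        { carrier := {y | pMap p F y ∈ W}
          zero_mem' := by
            change pMap p F 0 ∈ W
            rw [pMap_zero]
            exact zero_mem _
          add_mem' := fun {y y'} h h' => by
            change pMap p F (y + y') ∈ W
            rw [← sub_add_cancel (pMap p F (y + y')) (pMap p F y + pMap p F y')]
            exact add_mem (Submodule.mem_sup_left (hZ (hM.pMap_add_sub_mem y y')))
              (add_mem h h')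
          smul_mem' := fun a y h => by
            change pMap p F (a • y) ∈ W
            rw [pMap_smul]
            exact Submodule.smul_mem _ _ h }
      have hT : ∀ y, y ∈ T := by
        have hle : S ⊔ Submodule.span F (Set.range (pMap p F : M → M)^[k]) ≤ T := by
          refine sup_le (fun y hy => Submodule.mem_sup_left (hpow y hy)) (Submodule.span_le.2 ?_)
          rintro _ ⟨y, rfl⟩
          refine Submodule.mem_sup_right (Submodule.subset_span ⟨y, ?_⟩)
          rw [Function.iterate_succ_apply']
        exact fun y => hle (ih y)
      intro x
      obtain ⟨s, hs, z, hz, w, hw, rfl⟩ := hdec x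
      refine add_mem (Submodule.mem_sup_left hs) (add_mem (Submodule.mem_sup_left (hZ hz)) ?_)
      refine (Submodule.span_le.2 ?_ : _ ≤ W) hw
      rintro _ ⟨y, rfl⟩
      exact hT y
  rw [eq_top_iff]
  intro x _
  have hx := key N x
  have h0 : Submodule.span F (Set.range (pMap p F : M → M)^[N]) = ⊥ := by
    rw [Submodule.span_eq_bot]
    rintro _ ⟨y, rfl⟩
    exact hN y
  rwa [h0, sup_bot_eq] at hx

end Surjectivity

/-! ### The quotient by `L'^p + γ₃(L)` and induced surjections -/

section Quotient

variable (p : ℕ) (F L : Type*) [Field F] [LieRing L] [LieAlgebra F L] [RestrictedLieAlgebra p F L]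
  [hp : Fact p.Prime]

/-- The projection `L → L / (L'^p + γ₃(L))`. -/
def quotMap : L →ₗ⁅F⁆ L ⧸ powerGammaIdeal p F L :=
  LieHom.mk (LieSubmodule.Quotient.mk' (powerGammaIdeal p F L) :
    L →ₗ[F] L ⧸ powerGammaIdeal p F L) (by intro a b; rfl)

variable {p F L}

theorem quotMap_surjective : Function.Surjective (quotMap p F L) :=
  LieSubmodule.Quotient.surjective_mk' _

theorem quotMap_eq_zero_iff {x : L} : quotMap p F L x = 0 ↔ x ∈ powerGammaIdeal p F L :=
  LieSubmodule.Quotient.mk_eq_zero' (N := powerGammaIdeal p F L)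

theorem quotMap_pMap (x : L) : quotMap p F L (pMap p F x) = pMap p F (quotMap p F L x) := rfl

theorem quotMap_pMap_iterate (k : ℕ) : ∀ x : L,
    quotMap p F L ((pMap p F)^[k] x) = (pMap p F)^[k] (quotMap p F L x) := by
  induction k with
  | zero => intro x; rfl
  | succ k ih =>
    intro x
    rw [Function.iterate_succ_apply, Function.iterate_succ_apply, ih, quotMap_pMap]

variable (p F L) in
theorem isClassTwo_quotient : IsClassTwo p F (L ⧸ powerGammaIdeal p F L) where
  lie_lie_eq_zero a b c := by
    obtain ⟨x, rfl⟩ := quotMap_surjective a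
    obtain ⟨y, rfl⟩ := quotMap_surjective b
    obtain ⟨z, rfl⟩ := quotMap_surjective c
    rw [← LieHom.map_lie, ← LieHom.map_lie, quotMap_eq_zero_iff]
    refine Submodule.mem_sup_right (lie_mem_gammaThree_of_mem_derived ?_ x)
    exact LieSubmodule.lie_mem_lie (LieSubmodule.mem_top _) (LieSubmodule.mem_top _)
  pMap_eq_zero z hz := by
    obtain ⟨x, hx, rfl⟩ : ∃ x ∈ derivedIdeal F L, quotMap p F L x = z := by
      induction hz using Submodule.span_induction with
      | mem z hz =>
        obtain ⟨a, b, rfl⟩ := hz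
        obtain ⟨x, rfl⟩ := quotMap_surjective a
        obtain ⟨y, rfl⟩ := quotMap_surjective b
        exact ⟨⁅x, y⁆, LieSubmodule.lie_mem_lie (LieSubmodule.mem_top _)
          (LieSubmodule.mem_top _), LieHom.map_lie _ _ _⟩
      | zero => exact ⟨0, zero_mem _, map_zero _⟩
      | add a b _ _ ha hb =>
        obtain ⟨x, hx, rfl⟩ := ha
        obtain ⟨y, hy, rfl⟩ := hb
        exact ⟨x + y, add_mem hx hy, map_add _ _ _⟩
      | smul t a _ ha =>
        obtain ⟨x, hx, rfl⟩ := ha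
        exact ⟨t • x, SMulMemClass.smul_mem t hx, map_smul _ _ _⟩
    rw [← quotMap_pMap, quotMap_eq_zero_iff]
    refine Submodule.mem_sup_left ?_
    change pMap p F x ∈ pPower p (derivedIdeal F L).toLieSubalgebra
    rw [pPower, mem_restrictedClosure]
    exact fun K hK => hK.1 ⟨x, hx, rfl⟩

theorem isPNilpotent_quotient (h : IsPNilpotent p F L) :
    IsPNilpotent p F (L ⧸ powerGammaIdeal p F L) := by
  obtain ⟨n, hn⟩ := h
  refine ⟨n, fun a => ?_⟩
  obtain ⟨x, rfl⟩ := quotMap_surjective a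
  rw [← quotMap_pMap_iterate, hn, map_zero]

/-- Restricted homomorphisms to class two algebras factor through the quotient. -/
theorem IsClassTwo.eq_zero_of_mem_powerGammaIdeal {M : Type*} [LieRing M] [LieAlgebra F M]
    [RestrictedLieAlgebra p F M] (hM : IsClassTwo p F M) (ψ : L →ₗ⁅F⁆ M)
    (hψ : ∀ x, ψ (pMap p F x) = pMap p F (ψ x)) {x : L} (hx : x ∈ powerGammaIdeal p F L) :
    ψ x = 0 := by
  have hder : ∀ y ∈ derivedIdeal F L, ψ y ∈ bracketSpan F M := by
    intro y hy
    rw [← LieSubmodule.mem_toSubmodule, LieSubmodule.lieIdeal_oper_eq_linear_span'] at hy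
    induction hy using Submodule.span_induction with
    | mem y hy =>
      obtain ⟨a, _, b, _, rfl⟩ := hy
      rw [LieHom.map_lie]
      exact lie_mem_bracketSpan _ _
    | zero => rw [map_zero]; exact zero_mem _
    | add a b _ _ ha hb => rw [map_add]; exact add_mem ha hb
    | smul t a _ ha => rw [map_smul]; exact Submodule.smul_mem _ _ ha
  obtain ⟨a, ha, b, hb, rfl⟩ := Submodule.mem_sup.1 hx
  have ha' : ψ a = 0 := by
    have ha : a ∈ pPower p (derivedIdeal F L).toLieSubalgebra := ha
    rw [pPower, mem_restrictedClosure] at ha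
    have := ha ψ.ker.toLieSubalgebra ⟨?_, ?_⟩
    · exact LieHom.mem_ker.1 this
    · rintro _ ⟨y, hy, rfl⟩
      exact LieHom.mem_ker.2 (by rw [hψ, hM.pMap_eq_zero _ (hder y hy)])
    · intro y hy
      have hy : ψ y = 0 := LieHom.mem_ker.1 hy
      exact LieHom.mem_ker.2 (by rw [hψ, hy, pMap_zero])
  have hb' : ψ b = 0 := by
    clear hx
    simp only [gammaThree, LieModule.lowerCentralSeries_succ,
      LieModule.lowerCentralSeries_zero] at hb
    rw [LieSubmodule.lieIdeal_oper_eq_linear_span'] at hb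
    induction hb using Submodule.span_induction with
    | mem y hy =>
      obtain ⟨c, _, d, hd, rfl⟩ := hy
      rw [LieHom.map_lie]
      exact hM.lie_mem_right (hder d hd) _
    | zero => rw [map_zero]
    | add a b _ _ ha hb => rw [map_add, ha, hb, add_zero]
    | smul t a _ ha => rw [map_smul, ha, smul_zero]
  rw [map_add, ha', hb', add_zero]

/-- An augmented isomorphism of restricted enveloping algebras induces a surjection of the
quotients `L / (L'^p + γ₃(L))`. -/
theorem exists_surjective_restrictedHom [CharP F p] [PerfectField F] {H : Type*} [LieRing H]
    [LieAlgebra F H] [RestrictedLieAlgebra p F H]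
    (φ : RestrictedEnvelopingAlgebra p F L ≃ₐ[F] RestrictedEnvelopingAlgebra p F H)
    (hφ : ∀ u, augmentation p F H (φ u) = augmentation p F L u)
    [FiniteDimensional F (H ⧸ powerGammaIdeal p F H)]
    (hnil : IsPNilpotent p F (H ⧸ powerGammaIdeal p F H)) :
    ∃ ψ : (L ⧸ powerGammaIdeal p F L) →ₗ⁅F⁆ (H ⧸ powerGammaIdeal p F H),
      Function.Surjective ψ ∧ ∀ x, ψ (pMap p F x) = pMap p F (ψ x) := by
  have hM := isClassTwo_quotient p F H
  obtain ⟨π, hπι, hπlie, hπpow, hπmul⟩ := hM.exists_retraction hnil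
  let κ : RestrictedEnvelopingAlgebra p F H →ₐ[F]
      RestrictedEnvelopingAlgebra p F (H ⧸ powerGammaIdeal p F H) :=
    envLift ((envι p F).comp (quotMap p F H)) fun x => by
      rw [LieHom.comp_apply, LieHom.comp_apply, envι_pow, quotMap_pMap]
  have hκι : ∀ h, κ (envι p F h) = envι p F (quotMap p F H h) := fun h => envLift_ι _ _ h
  have hκ : ∀ u, augmentation p F _ (κ (φ u)) = augmentation p F L u := by
    have h : (augmentation p F _).comp κ = augmentation p F H := env_hom_ext fun x => by
      rw [AlgHom.comp_apply, hκι, augmentation_ι, augmentation_ι]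
    intro u
    rw [← hφ, ← h, AlgHom.comp_apply]
  -- Although `π` is not multiplicative, it respects commutators, which is enough for a Lie
  -- homomorphism.
  let ψ : L →ₗ⁅F⁆ H ⧸ powerGammaIdeal p F H :=
    { π ∘ₗ κ.toLinearMap ∘ₗ φ.toLinearMap ∘ₗ
        (envι p F : L →ₗ⁅F⁆ RestrictedEnvelopingAlgebra p F L).toLinearMap with
      map_lie' := fun {x y} => by
        change π (κ (φ (envι p F ⁅x, y⁆))) = ⁅π (κ (φ (envι p F x))), π (κ (φ (envι p F y)))⁆
        rw [← hπlie, LieHom.map_lie, LieRing.of_associative_ring_bracket]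
        simp only [map_sub, map_mul] }
  have hψ : ∀ x, ψ x = π (κ (φ (envι p F x))) := fun x => rfl
  have hψp : ∀ x, ψ (pMap p F x) = pMap p F (ψ x) := fun x => by
    rw [hψ, hψ, ← envι_pow, map_pow, map_pow, hπpow _ (by rw [hκ, augmentation_ι])]
  have hsurj : LinearMap.range (ψ : L →ₗ[F] H ⧸ powerGammaIdeal p F H) = ⊤ := by
    refine hM.eq_top_of_generates hnil _ ?_ ?_ ?_
    · rintro _ ⟨x, rfl⟩ _ ⟨y, rfl⟩
      exact ⟨⁅x, y⁆, LieHom.map_lie ψ x y⟩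
    · rintro _ ⟨x, rfl⟩
      exact ⟨pMap p F x, hψp x⟩
    · rw [eq_top_iff]
      intro m _
      obtain ⟨h, rfl⟩ := quotMap_surjective m
      have h0 : augmentation p F L (φ.symm (envι p F h)) = 0 := by
        rw [← hφ, AlgEquiv.apply_symm_apply, augmentation_ι]
      -- Pulled back to `u(L)`, the element `h` is some `x` in `L` modulo `ω²`, and `π` sends the
      -- error to brackets and `p`-powers.
      obtain ⟨x, hx⟩ := exists_eq_ι_add (φ.symm (envι p F h))
      rw [h0, map_zero, sub_zero] at hx
      have h1 : quotMap p F H h = ψ x + π (κ (φ (φ.symm (envι p F h) - envι p F x))) := by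
        rw [map_sub, map_sub, map_sub, AlgEquiv.apply_symm_apply, hκι, hπι, hψ,
          add_sub_cancel]
      rw [h1]
      refine add_mem (Submodule.mem_sup_left ⟨x, rfl⟩) (Submodule.mem_sup_right ?_)
      generalize φ.symm (envι p F h) - envι p F x = w at hx
      induction hx using Submodule.span_induction with
      | mem w hw =>
        obtain ⟨a, b, ha, hb, rfl⟩ := hw
        rw [map_mul, map_mul]
        exact hπmul _ _ (by rw [hκ, ha]) (by rw [hκ, hb])
      | zero => simp
      | add a b _ _ ha hb => rw [map_add, map_add, map_add]; exact add_mem ha hb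
      | smul t a _ ha => rw [map_smul, map_smul, map_smul]; exact Submodule.smul_mem _ _ ha
  let ψq : (L ⧸ powerGammaIdeal p F L) →ₗ[F] H ⧸ powerGammaIdeal p F H :=
    (powerGammaIdeal p F L).toSubmodule.liftQ ψ.toLinearMap
      fun x hx => hM.eq_zero_of_mem_powerGammaIdeal ψ hψp hx
  have hψq : ∀ x, ψq (quotMap p F L x) = ψ x := fun x => rfl
  refine ⟨{ ψq with map_lie' := fun {a b} => ?_ }, fun m => ?_, fun a => ?_⟩
  · obtain ⟨x, rfl⟩ := quotMap_surjective a
    obtain ⟨y, rfl⟩ := quotMap_surjective b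
    change ψq ⁅quotMap p F L x, quotMap p F L y⁆ = ⁅ψq (quotMap p F L x), ψq (quotMap p F L y)⁆
    rw [← LieHom.map_lie, hψq, hψq, hψq, LieHom.map_lie]
  · obtain ⟨x, hx⟩ := LinearMap.range_eq_top.1 hsurj m
    exact ⟨quotMap p F L x, hx⟩
  · obtain ⟨x, rfl⟩ := quotMap_surjective a
    change ψq (pMap p F (quotMap p F L x)) = pMap p F (ψq (quotMap p F L x))
    rw [← quotMap_pMap, hψq, hψq, hψp]

end Quotient

/-! ### Transfer of finiteness and nilpotency to `H` -/

section Finiteness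

variable {p : ℕ} {F : Type*} [Field F]

/-- A class two Lie algebra is finite-dimensional if its abelianization is. -/
theorem IsClassTwo.finiteDimensional {M : Type*} [LieRing M] [LieAlgebra F M]
    [RestrictedLieAlgebra p F M] (hM : IsClassTwo p F M)
    [FiniteDimensional F (M ⧸ bracketSpan F M)] : FiniteDimensional F M := by
  obtain ⟨X, hX⟩ := (bracketSpan F M).exists_isCompl
  have : FiniteDimensional F X :=
    Module.Finite.equiv ((bracketSpan F M).quotientEquivOfIsCompl X hX)
  let br : M →ₗ[F] M →ₗ[F] M := (LieAlgebra.ad F M).toLinearMap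
  -- Brackets are central, so all of them come from a complement of `bracketSpan F M`.
  have hle : bracketSpan F M ≤ Submodule.map₂ br X X := by
    refine Submodule.span_le.2 ?_
    rintro _ ⟨x, y, rfl⟩
    have hdec : ∀ x : M, ∃ z ∈ bracketSpan F M, ∃ a ∈ X, z + a = x := fun x =>
      Submodule.mem_sup.1 (by rw [hX.sup_eq_top]; trivial)
    obtain ⟨z, hz, a, ha, rfl⟩ := hdec x
    obtain ⟨w, hw, b, hb, rfl⟩ := hdec y
    rw [add_lie, hM.lie_mem_left hz, zero_add, lie_add, hM.lie_mem_right hw, zero_add]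
    exact Submodule.apply_mem_map₂ br ha hb
  have hX' : X.FG := Module.Finite.iff_fg.1 inferInstance
  have : FiniteDimensional F (Submodule.map₂ br X X) := Module.Finite.iff_fg.2 (hX'.map₂ br hX')
  have : FiniteDimensional F (bracketSpan F M) := Submodule.finiteDimensional_of_le hle
  exact Module.Finite.of_submodule_quotient (bracketSpan F M)

variable [hp : Fact p.Prime] {L H : Type*} [LieRing L] [LieAlgebra F L] [RestrictedLieAlgebra p F L]
  [LieRing H] [LieAlgebra F H] [RestrictedLieAlgebra p F H]

/-- Under an algebra map from `u(L)` to a commutative algebra, with `L` `p`-nilpotent, the image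
of the augmentation ideal consists of nilpotent elements. -/
theorem map_sub_augmentation_pow [CharP F p] {A : Type*} [CommRing A] [Algebra F A] {n : ℕ}
    (hn : ∀ x : L, (pMap p F)^[n] x = 0) (f : RestrictedEnvelopingAlgebra p F L →ₐ[F] A)
    (u : RestrictedEnvelopingAlgebra p F L) :
    (f u - algebraMap F A (augmentation p F L u)) ^ p ^ n = 0 := by
  rcases subsingleton_or_nontrivial A with hA | hA
  · exact Subsingleton.elim _ _
  have : CharP A p := charP_of_injective_algebraMap (algebraMap F A).injective p
  induction u using env_induction with
  | hι x =>
    rw [augmentation_ι, map_zero, sub_zero, ← map_pow, envι_pow_pow, hn, map_zero, map_zero]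
  | hF a => simp [hp.out.ne_zero]
  | hadd u v hu hv =>
    rw [map_add, map_add, map_add, add_sub_add_comm, add_pow_char_pow, hu, hv, add_zero]
  | hmul u v hu hv =>
    have : f (u * v) - algebraMap F A (augmentation p F L (u * v)) =
        (f u - algebraMap F A (augmentation p F L u)) * f v +
          algebraMap F A (augmentation p F L u) *
            (f v - algebraMap F A (augmentation p F L v)) := by
      rw [map_mul, map_mul, map_mul]
      ring
    rw [this, add_pow_char_pow, mul_pow, mul_pow, hu, hv, zero_mul, mul_zero, add_zero]

/-- If `u(L) ≅ u(H)` with `L` finite-dimensional and `p`-nilpotent, then `H / (H'^p + γ₃(H))` is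
finite-dimensional and `p`-nilpotent. -/
theorem finiteDimensional_isPNilpotent_quotient [CharP F p] [FiniteDimensional F L]
    (hnil : IsPNilpotent p F L)
    (φ : RestrictedEnvelopingAlgebra p F L ≃ₐ[F] RestrictedEnvelopingAlgebra p F H)
    (hφ : ∀ u, augmentation p F H (φ u) = augmentation p F L u) :
    FiniteDimensional F (H ⧸ powerGammaIdeal p F H) ∧
      IsPNilpotent p F (H ⧸ powerGammaIdeal p F H) := by
  obtain ⟨n, hn⟩ := hnil
  have hM := isClassTwo_quotient p F H
  let Z := bracketSpan F (H ⧸ powerGammaIdeal p F H)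
  -- The embedding makes the abelianization visible to algebra maps out of `u(H) ≅ u(L)`.
  obtain ⟨B, I, g, hg, hgp⟩ := exists_injective_pow_eq hM.abelianPMap
  let f : H →ₗ⁅F⁆ MvPolynomial B F ⧸ I :=
    { g ∘ₗ Z.mkQ ∘ₗ (quotMap p F H).toLinearMap with
      map_lie' := fun {x y} => by
        change g (Z.mkQ (quotMap p F H ⁅x, y⁆)) = _ * _ - _ * _
        rw [LieHom.map_lie, Submodule.mkQ_apply,
          (Submodule.Quotient.mk_eq_zero _).2 (lie_mem_bracketSpan _ _), map_zero, mul_comm,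
          sub_self] }
  have hf : ∀ x, f x = g (Z.mkQ (quotMap p F H x)) := fun x => rfl
  let G := (envLift (p := p) f fun x => by
    rw [hf, hf, hgp, quotMap_pMap, ← hM.abelianPMap_mkQ]).comp φ.toAlgHom
  have hG : ∀ x, G (φ.symm (envι p F x)) = f x := fun x => by
    change envLift f _ (φ (φ.symm (envι p F x))) = _
    rw [AlgEquiv.apply_symm_apply, envLift_ι]
  have hrep : ∀ v, ∃ x, f x = g v := fun v => by
    obtain ⟨m, rfl⟩ := Z.mkQ_surjective v
    obtain ⟨x, rfl⟩ := quotMap_surjective m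
    exact ⟨x, rfl⟩
  constructor
  · let bL := Module.finBasis F L
    -- The image of `u(L)` is commutative and generated by finitely many nilpotent elements, hence
    -- finite-dimensional.
    let S := Algebra.adjoin F (Set.range fun i => G (envι p F (bL i)))
    have hfin : Module.Finite F S := by
      refine Algebra.finite_adjoin_of_finite_of_isIntegral (Set.finite_range _) ?_
      rintro _ ⟨i, rfl⟩
      refine IsIntegral.of_pow (pow_pos hp.out.pos n) ?_
      rw [← map_pow, envι_pow_pow, hn, map_zero, map_zero]
      exact isIntegral_zero
    have hS : ∀ u, G u ∈ S := by
      intro u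
      induction u using env_induction with
      | hι x =>
        rw [← bL.sum_repr x, map_sum, map_sum]
        refine sum_mem fun i _ => ?_
        rw [map_smul, map_smul]
        exact S.smul_mem (Algebra.subset_adjoin ⟨i, rfl⟩) _
      | hF a => rw [AlgHom.commutes]; exact S.algebraMap_mem a
      | hadd u v hu hv => rw [map_add]; exact add_mem hu hv
      | hmul u v hu hv => rw [map_mul]; exact mul_mem hu hv
    have hgS : ∀ v, g v ∈ S.toSubmodule := fun v => by
      obtain ⟨x, hx⟩ := hrep v
      rw [← hx, ← hG]
      exact hS _
    have : Module.Finite F S.toSubmodule := hfin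
    have : FiniteDimensional F ((H ⧸ powerGammaIdeal p F H) ⧸ Z) :=
      FiniteDimensional.of_injective (g.codRestrict S.toSubmodule hgS)
        fun v w h => hg (congrArg Subtype.val h)
    exact hM.finiteDimensional
  · have hgk : ∀ (k : ℕ) v, g v ^ p ^ k = g (hM.abelianPMap^[k] v) := by
      intro k
      induction k with
      | zero => simp
      | succ k ih =>
        intro v
        rw [pow_succ', pow_mul, hgp, ih, Function.iterate_succ_apply]
    -- After `n` steps the element lies in the derived part, and one more application of the `p`-map
    -- kills it.
    refine ⟨n + 1, fun m => ?_⟩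
    rw [Function.iterate_succ_apply']
    refine hM.pMap_eq_zero _ ?_
    rw [← Submodule.Quotient.mk_eq_zero, ← Submodule.mkQ_apply, ← hM.abelianPMap_iterate]
    apply hg
    rw [map_zero, ← hgk]
    obtain ⟨x, hx⟩ := hrep (Z.mkQ m)
    have h := map_sub_augmentation_pow hn G (φ.symm (envι p F x))
    rwa [← hφ, AlgEquiv.apply_symm_apply, augmentation_ι, map_zero, sub_zero, hG, hx] at h

end Finiteness

end RestrictedLieAlgebra

/-! ### The main theorem -/

theorem mainTheorem1 (p : ℕ) [Fact p.Prime] (F : Type*) [Field F] [CharP F p] [PerfectField F]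
    (L : Type*) [LieRing L] [LieAlgebra F L] [RestrictedLieAlgebra p F L]
    (H : Type*) [LieRing H] [LieAlgebra F H] [RestrictedLieAlgebra p F H]
    (hfin : FiniteDimensional F L) (hnil : RestrictedLieAlgebra.IsPNilpotent p F L)
    (φ : RestrictedLieAlgebra.RestrictedEnvelopingAlgebra p F L ≃ₐ[F]
      RestrictedLieAlgebra.RestrictedEnvelopingAlgebra p F H) :
    Nonempty (RestrictedLieAlgebra.RestrictedLieEquiv p F
      (L ⧸ RestrictedLieAlgebra.powerGammaIdeal p F L)
      (H ⧸ RestrictedLieAlgebra.powerGammaIdeal p F H)) := by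
  open RestrictedLieAlgebra in
  -- The given isomorphism need not be augmented by hypothesis, but `u(L)` has only one algebra map
  -- to `F`.
  have hφ : ∀ u, augmentation p F H (φ u) = augmentation p F L u := fun u =>
    congrArg (fun f => f u)
      (eq_augmentation_of_isPNilpotent hnil ((augmentation p F H).comp φ.toAlgHom))
  have hφ' : ∀ u, augmentation p F L (φ.symm u) = augmentation p F H u := fun u => by
    rw [← hφ, AlgEquiv.apply_symm_apply]
  obtain ⟨hfinH, hnilH⟩ := finiteDimensional_isPNilpotent_quotient hnil φ hφ
  have hfinL : FiniteDimensional F (L ⧸ powerGammaIdeal p F L) :=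
    Module.Finite.of_surjective (quotMap p F L).toLinearMap quotMap_surjective
  obtain ⟨ψ, hψ, hψp⟩ := exists_surjective_restrictedHom φ hφ hnilH
  -- The reverse surjection serves only to compare dimensions.
  obtain ⟨χ, hχ, -⟩ := exists_surjective_restrictedHom φ.symm hφ' (isPNilpotent_quotient hnil)
  have hdim : Module.finrank F (L ⧸ powerGammaIdeal p F L) =
      Module.finrank F (H ⧸ powerGammaIdeal p F H) :=
    le_antisymm (LinearMap.finrank_le_finrank_of_surjective (f := χ.toLinearMap) hχ)
      (LinearMap.finrank_le_finrank_of_surjective (f := ψ.toLinearMap) hψ)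
  have hinj : Function.Injective ψ :=
    (LinearMap.injective_iff_surjective_of_finrank_eq_finrank (f := ψ.toLinearMap) hdim).2 hψ
  exact ⟨{ LieEquiv.ofBijective ψ ⟨hinj, hψ⟩ with map_pMap := hψp }⟩
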